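/- Let $G$ be a finite simple graph with vertex set $V=\{x_1,\dots,x_n\}$, let $K$ be a field, and let $I(G)\subset S=K[x_1,\dots,x_n]$ be the edge ideal of $G$, generated by the monomials $x_ix_j$ with $\{x_i,x_j\}$ an edge of $G$. For $\mathfrak c=(c_1,\dots,c_n)\in\mathbb Z_{>0}^n$ and a monomial ideal $I\subset S$, let $I_{\mathfrak c}$ be the ideal generated by the monomials $x_1^{a_1}\cdots x_n^{a_n}\in I$ with $a_i\le c_i$ for all $i$, and let $\delta_{\mathfrak c}(I)$ be the largest integer $q$ with $(I^q)_{\mathfrak c}\ne 0$. Let $\mathcal W(\mathfrak c,G)$ be the minimal set of monomial generators of $(I(G)^{\delta_{\mathfrak c}(I(G))})_{\mathfrak c}$. We say that $G$ enjoys the strong exchange property if for every $\mathfrak c\in\mathbb Z_{>0}^n$ the following holds: whenever $w=x_1^{a_1}\cdots x_n^{a_n}$ and $w'=x_1^{b_1}\cdots x_n^{b_n}$ belong to $\mathcal W(\mathfrak c,G)$ and $\xi,\rho$ are indices with $a_\xi>b_\xi$ and $a_\rho<b_\rho$, then $x_\rho(w/x_\xi)\in\mathcal W(\mathfrak c,G)$.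 Let $C_\ell$ denote the cycle of length $\ell$. Attaching a path of length $m$ to a vertex $v$ of a graph means adding $m$ new vertices $y_1,\dots,y_m$ and the $m$ edges $\{v,y_1\},\{y_1,y_2\},\dots,\{y_{m-1},y_m\}$; attaching a pendant edge means attaching a path of length one. A unicyclic graph is a finite connected graph having exactly one cycle. Descriptions of graphs below are up to isomorphism. **Theorem.** Let $G$ be a unicyclic graph and let $\ell\ge 3$ be the length of its unique cycle. (i) If $\ell\ge 8$, then $G$ does not enjoy the strong exchange property. (ii) If $\ell\in\{5,6,7\}$, then $G$ enjoys the strong exchange property if and only if the independence number of $G$ is at most three. (iii) If $\ell=4$, then $G$ enjoys the strong exchange property if and only if one of the following holds: (1) $G$ is obtained from $C_4$ by attaching at most one pendant edge to each of its vertices; (2) $G$ is obtained from the cycle $C_4$ with vertices $x_1,x_2,x_3,x_4$ (in cyclic order) by attaching a path of length two to $x_1$ and a pendant edge to $x_3$, that is, $G$ has vertices $x_1,\dots,x_7$ and edges $\{x_1,x_2\},\{x_2,x_3\},\{x_3,x_4\},\{x_4,x_1\},\{x_1,x_5\},\{x_5,x_6\},\{x_3,x_7\}$; (3) $G$ is obtained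 from $C_4$ by attaching a path of length two to one of its vertices. (iv) If $\ell=3$, then $G$ enjoys the strong exchange property if and only if one of the following holds: (1) $G$ is obtained from $C_3$ by attaching at most one path, of length at most two, to each of its vertices; (2) $G$ is obtained from $C_3$ by attaching a path of length three to one of its vertices; (3) $G$ is obtained from $C_3$ by attaching a finite number of paths of length at most two to one of its vertices. -/

import Mathlib

noncomputable section

namespace BoundedPowers

open MvPolynomial

/-- The edge ideal `I(G)` in `K[x_v : v ∈ V]`, generated by the monomials `x_u x_v` with `{u, v}`
an edge of `G`. -/
def edgeIdeal {V : Type*} (K : Type*) [Field K] (G : SimpleGraph V) : Ideal (MvPolynomial V K) :=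
  Ideal.span {f | ∃ u v, G.Adj u v ∧ f = X u * X v}

/-- The ideal `I_c` generated by the monomials of `I` whose exponent vector is bounded above
componentwise by `c`. -/
def boundedPart {V K : Type*} [Field K] (c : V → ℕ) (I : Ideal (MvPolynomial V K)) :
    Ideal (MvPolynomial V K) :=
  Ideal.span {f | ∃ a : V →₀ ℕ, (∀ i, a i ≤ c i) ∧ monomial a (1 : K) ∈ I ∧ f = monomial a 1}

/-- `δ_c(I)`, the largest `q` with `(I ^ q)_c ≠ 0`. (For an edge ideal of a finite graph
the set below contains `0` and is bounded, by degree reasons.) -/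
def delta {V K : Type*} [Field K] (c : V → ℕ) (I : Ideal (MvPolynomial V K)) : ℕ :=
  sSup {q | boundedPart c (I ^ q) ≠ ⊥}

/-- The (exponent vectors of the) minimal monomial generators of a monomial ideal `J`: the monomials
of `J` that are minimal with respect to divisibility. -/
def minimalMonomialGenerators {V K : Type*} [Field K] (J : Ideal (MvPolynomial V K)) :
    Set (V →₀ ℕ) :=
  {a | Minimal (fun b : V →₀ ℕ => monomial b (1 : K) ∈ J) a}

/-- `W(c, G)`: the (exponent vectors of the) minimal monomial generators of
`(I(G) ^ δ_c(I(G)))_c`. -/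
def W {V : Type*} (K : Type*) [Field K] (c : V → ℕ) (G : SimpleGraph V) : Set (V →₀ ℕ) :=
  minimalMonomialGenerators (boundedPart c (edgeIdeal K G ^ delta c (edgeIdeal K G)))

/-- The strong exchange property of a set of monomials (given by their exponent vectors). -/
def StrongExchange {V : Type*} (B : Set (V →₀ ℕ)) : Prop :=
  ∀ a ∈ B, ∀ b ∈ B, ∀ ξ ρ : V, b ξ < a ξ → a ρ < b ρ →
    a - Finsupp.single ξ 1 + Finsupp.single ρ 1 ∈ B

/-- `G` enjoys the strong exchange property: `W(c, G)` has it for every positive vector `c`. -/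
def EnjoysStrongExchange {V : Type*} (K : Type*) [Field K] (G : SimpleGraph V) : Prop :=
  ∀ c : V → ℕ, (∀ i, 0 < c i) → StrongExchange (W K c G)

/-- `C` is a cycle of `G`, regarded as a subgraph. -/
def IsCycleSubgraph {V : Type*} {G : SimpleGraph V} (C : G.Subgraph) : Prop :=
  ∃ (x : V) (p : G.Walk x x), p.IsCycle ∧ p.toSubgraph = C

/-- A unicyclic graph: connected, with exactly one cycle. (Finiteness is a separate assumption.) -/
def IsUnicyclic {V : Type*} (G : SimpleGraph V) : Prop :=
  G.Connected ∧ ∃! C : G.Subgraph, IsCycleSubgraph C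

/-- The graph obtained from `H` by attaching, for each `i : ι`, a path of length `L i` (with `L i`
edges and `L i` new vertices `⟨i, 0⟩, ⟨i, 1⟩, …`) to the vertex `r i` of `H`. A path of length one
is a pendant edge; attaching a path of length zero changes nothing. -/
def attachPaths {U ι : Type*} (H : SimpleGraph U) (r : ι → U) (L : ι → ℕ) :
    SimpleGraph (U ⊕ (Σ i, Fin (L i))) where
  Adj
    | Sum.inl u, Sum.inl v => H.Adj u v
    | Sum.inl u, Sum.inr q => u = r q.1 ∧ (q.2 : ℕ) = 0
    | Sum.inr q, Sum.inl u => u = r q.1 ∧ (q.2 : ℕ) = 0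
    | Sum.inr q, Sum.inr q' =>
        q.1 = q'.1 ∧ ((q.2 : ℕ) + 1 = (q'.2 : ℕ) ∨ (q'.2 : ℕ) + 1 = (q.2 : ℕ))
  symm := ⟨by
    rintro (u | q) (v | q') h
    · exact SimpleGraph.Adj.symm h
    · exact h
    · exact h
    · exact ⟨h.1.symm, h.2.symm⟩⟩
  loopless := ⟨by
    rintro (u | q) h
    · exact SimpleGraph.irrefl H h
    · have := h.2
      omega⟩

end BoundedPowers

end

/-! ### Bounded powers of the edge ideal as degree vectors of edge multisets. -/

namespace BoundedPowers

open MvPolynomial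

variable {V : Type*}

/-! A product of `q` edge monomials is the degree vector of a multiset of `q` edges, and all these
products have the same degree. Hence `W K c G` consists of the degree vectors of the largest edge
multisets with degrees bounded by `c` (`mem_W_iff`), and strong exchange asks that such a maximum
multiset can pass one unit of degree from `ξ` to `ρ`.

Two configurations obstruct this: `HasTwoCherries` and `HasTriangleAndCherry`. For each there is a
capacity `c` under which the maximum multisets are essentially choices of one edge at each vertex
outside a fixed set; two such choices ask for an exchange that a weighted degree count forbids.
Conversely, let `M` and `M'` be maximum multisets. Alternating walks that leave `ρ` and `ξ` along
edges of `M' - M` and `M - M'` either realise the exchange, or allow induction, or stop after two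
edges; in the last case maximality supplies the nonadjacencies of an obstruction, or else two
triangles that do not coincide (`IsMaxBounded.exists_exchange`). Unicyclic graphs have at most one
triangle, so for them strong exchange means the absence of both obstructions, and for `ℓ ≥ 4` the
absence of two cherries.

It remains to find the unicyclic graphs without obstructions. Edges off the cycle are bridges, so
the graph is an induced cycle with rooted trees (`IsCycleWithTrees`). A cycle of length at least 8
contains two cherries. For lengths 6 and 7 no tree can be attached, and for length 5 only one path
of length at most two; this forces independence number at most three, while two cherries always
contain four independent vertices. For lengths 4 and 3 the surviving trees give the listed graphs.
That the listed graphs carry no obstruction is a finite check, except for the bouquets of paths at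
one vertex of a triangle, where the hub lies in every triangle and in every cherry not centred at
it. -/

open Classical in
/-- The number of edges of the multiset `M` that contain `v`. -/
noncomputable def edgeDegree (M : Multiset (Sym2 V)) (v : V) : ℕ := M.countP (v ∈ ·)

@[simp] theorem edgeDegree_zero (v : V) : edgeDegree 0 v = 0 := by simp [edgeDegree]

open Classical in
theorem edgeDegree_cons (u w : V) (M : Multiset (Sym2 V)) (v : V) :
    edgeDegree (s(u, w) ::ₘ M) v = edgeDegree M v + if v = u ∨ v = w then 1 else 0 := by
  simp [edgeDegree, Multiset.countP_cons]

theorem edgeDegree_add (M N : Multiset (Sym2 V)) (v : V) :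
    edgeDegree (M + N) v = edgeDegree M v + edgeDegree N v := by
  simp [edgeDegree]

/-- `M` is a multiset of `q` edges of `G`. -/
def IsEdgeMultiset (G : SimpleGraph V) (M : Multiset (Sym2 V)) : Prop := ∀ e ∈ M, e ∈ G.edgeSet

/-- The degree vectors of the multisets of `q` edges of `G`. -/
def degreeVectors (G : SimpleGraph V) (q : ℕ) : Set (V →₀ ℕ) :=
  {a | ∃ M, IsEdgeMultiset G M ∧ M.card = q ∧ ∀ v, edgeDegree M v = a v}

open Classical in
theorem edgeIdeal_eq_span (K : Type*) [Field K] (G : SimpleGraph V) :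
    edgeIdeal K G = Ideal.span ((fun a => monomial a (1 : K)) ''
      {a | ∃ u v, G.Adj u v ∧ a = Finsupp.single u 1 + Finsupp.single v 1}) := by
  unfold edgeIdeal
  congr 1
  ext f
  constructor
  · rintro ⟨u, v, h, rfl⟩
    exact ⟨_, ⟨u, v, h, rfl⟩, by simp [X, monomial_mul]⟩
  · rintro ⟨_, ⟨u, v, h, rfl⟩, rfl⟩
    exact ⟨u, v, h, by simp [X, monomial_mul]⟩

open Classical in
theorem mem_degreeVectors_succ {G : SimpleGraph V} {q : ℕ} {a : V →₀ ℕ} :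
    a ∈ degreeVectors G (q + 1) ↔ ∃ b ∈ degreeVectors G q, ∃ u v, G.Adj u v ∧
      a = b + (Finsupp.single u 1 + Finsupp.single v 1) := by
  constructor
  · rintro ⟨M, hM, hc, hd⟩
    obtain ⟨e, he⟩ := Multiset.card_pos_iff_exists_mem.1 (show 0 < M.card by omega)
    obtain ⟨N, rfl⟩ := Multiset.exists_cons_of_mem he
    induction e with | h u v =>
    have huv : G.Adj u v := hM _ (Multiset.mem_cons_self _ _)
    refine ⟨a - (Finsupp.single u 1 + Finsupp.single v 1),
      ⟨N, fun e he => hM e (Multiset.mem_cons_of_mem he), by simpa using hc, fun w => ?_⟩, u, v, huv, ?_⟩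
    · have := hd w
      rw [edgeDegree_cons] at this
      have hne := huv.ne
      simp only [Finsupp.tsub_apply, Finsupp.add_apply, Finsupp.single_apply, ← this]
      grind
    · ext w
      have := hd w
      rw [edgeDegree_cons] at this
      have hne := huv.ne
      simp only [Finsupp.tsub_apply, Finsupp.add_apply, Finsupp.single_apply, ← this]
      grind
  · rintro ⟨b, ⟨N, hN, hc, hd⟩, u, v, huv, rfl⟩
    refine ⟨s(u, v) ::ₘ N, ?_, by simp [hc], fun w => ?_⟩
    · intro e he
      rcases Multiset.mem_cons.1 he with rfl | he
      exacts [huv, hN e he]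
    · have hne := huv.ne
      rw [edgeDegree_cons, hd]
      simp only [Finsupp.add_apply, Finsupp.single_apply]
      grind

theorem edgeIdeal_pow (K : Type*) [Field K] (G : SimpleGraph V) (q : ℕ) :
    edgeIdeal K G ^ q = Ideal.span ((fun a => monomial a (1 : K)) '' degreeVectors G q) := by
  induction q with
  | zero =>
    have : (0 : V →₀ ℕ) ∈ degreeVectors G 0 := ⟨0, by simp [IsEdgeMultiset], rfl, by simp⟩
    rw [pow_zero, Ideal.one_eq_top, eq_comm, Ideal.eq_top_iff_one]
    exact Ideal.subset_span ⟨0, this, by simp⟩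
  | succ q ih =>
    rw [pow_succ, ih, edgeIdeal_eq_span, Ideal.span_mul_span']
    congr 1
    ext f
    simp only [Set.mem_mul, Set.mem_image, mem_degreeVectors_succ]
    constructor
    · rintro ⟨_, ⟨b, hb, rfl⟩, _, ⟨_, ⟨u, v, huv, rfl⟩, rfl⟩, rfl⟩
      exact ⟨_, ⟨b, hb, u, v, huv, rfl⟩, by simp [monomial_mul]⟩
    · rintro ⟨_, ⟨b, hb, u, v, huv, rfl⟩, rfl⟩
      exact ⟨_, ⟨b, hb, rfl⟩, _, ⟨_, ⟨u, v, huv, rfl⟩, rfl⟩, by simp [monomial_mul]⟩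

theorem monomial_mem_span_iff {K : Type*} [Field K] {S : Set (V →₀ ℕ)} {b : V →₀ ℕ} :
    monomial b (1 : K) ∈ Ideal.span ((fun a => monomial a (1 : K)) '' S) ↔ ∃ a ∈ S, a ≤ b := by
  classical
  rw [mem_ideal_span_monomial_image]
  simp [support_monomial]

theorem boundedPart_edgeIdeal_pow (K : Type*) [Field K] (c : V → ℕ) (G : SimpleGraph V) (q : ℕ) :
    boundedPart c (edgeIdeal K G ^ q) = Ideal.span ((fun a => monomial a (1 : K)) ''
      {a | (∀ v, a v ≤ c v) ∧ ∃ e ∈ degreeVectors G q, e ≤ a}) := by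
  unfold boundedPart
  congr 1
  ext f
  rw [edgeIdeal_pow]
  simp only [monomial_mem_span_iff]
  constructor
  · rintro ⟨a, h1, h2, rfl⟩
    exact ⟨a, ⟨h1, h2⟩, rfl⟩
  · rintro ⟨a, ⟨h1, h2⟩, rfl⟩
    exact ⟨a, h1, h2, rfl⟩

/-- Divisors of bounded monomials are bounded, so the bound can be imposed on the degree vector
itself. -/
theorem monomial_mem_boundedPart_iff {K : Type*} [Field K] {c : V → ℕ} {G : SimpleGraph V} {q : ℕ}
    {b : V →₀ ℕ} : monomial b (1 : K) ∈ boundedPart c (edgeIdeal K G ^ q) ↔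
      ∃ e ∈ degreeVectors G q, (∀ v, e v ≤ c v) ∧ e ≤ b := by
  rw [boundedPart_edgeIdeal_pow, monomial_mem_span_iff]
  constructor
  · rintro ⟨a, ⟨h1, e, he, hea⟩, hab⟩
    exact ⟨e, he, fun v => (hea v).trans (h1 v), hea.trans hab⟩
  · rintro ⟨e, he, hec, heb⟩
    exact ⟨e, ⟨hec, e, he, le_rfl⟩, heb⟩

theorem boundedPart_ne_bot_iff {K : Type*} [Field K] {c : V → ℕ} {G : SimpleGraph V} {q : ℕ} :
    boundedPart c (edgeIdeal K G ^ q) ≠ ⊥ ↔ ∃ e ∈ degreeVectors G q, ∀ v, e v ≤ c v := by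
  constructor
  · intro h
    by_contra! hne
    refine h ?_
    rw [boundedPart_edgeIdeal_pow, Ideal.span_eq_bot]
    rintro _ ⟨a, ⟨h1, e, he, hea⟩, rfl⟩
    obtain ⟨v, hv⟩ := hne e he
    exact absurd ((hea v).trans (h1 v)) (by omega)
  · rintro ⟨e, he, hec⟩ h
    have : monomial e (1 : K) ∈ boundedPart c (edgeIdeal K G ^ q) :=
      monomial_mem_boundedPart_iff.2 ⟨e, he, hec, le_rfl⟩
    rw [h, Ideal.mem_bot, monomial_eq_zero] at this
    exact one_ne_zero this

/-- Every edge counts twice in the degree sum. -/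
theorem sum_edgeDegree [Fintype V] {G : SimpleGraph V} {M : Multiset (Sym2 V)}
    (hM : IsEdgeMultiset G M) : ∑ v, edgeDegree M v = 2 * M.card := by
  classical
  induction M using Multiset.induction with
  | empty => simp
  | cons e M ih =>
    induction e with | h u w =>
    have huw : G.Adj u w := hM _ (Multiset.mem_cons_self _ _)
    simp only [edgeDegree_cons, Finset.sum_add_distrib,
      ih fun e he => hM e (Multiset.mem_cons_of_mem he), Finset.sum_boole, Multiset.card_cons]
    have : Finset.univ.filter (fun v => v = u ∨ v = w) = {u, w} := by ext; simp
    rw [this, Finset.card_pair huw.ne]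
    push_cast; ring

/-- `M` is a maximum multiset of edges of `G` among those with degrees bounded by `c`. -/
structure IsMaxBounded (G : SimpleGraph V) (c : V → ℕ) (M : Multiset (Sym2 V)) : Prop where
  edge : IsEdgeMultiset G M
  le : ∀ v, edgeDegree M v ≤ c v
  max : ∀ N, IsEdgeMultiset G N → (∀ v, edgeDegree N v ≤ c v) → N.card ≤ M.card

/-- The bridge from algebra to combinatorics: the rest of the proof speaks only of edge multisets.
-/
theorem mem_W_iff [Finite V] {K : Type*} [Field K] {c : V → ℕ} {G : SimpleGraph V} {a : V →₀ ℕ} :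
    a ∈ W K c G ↔ ∃ M, IsMaxBounded G c M ∧ ∀ v, edgeDegree M v = a v := by
  classical
  have := Fintype.ofFinite V
  set S : Set ℕ := {q | boundedPart c (edgeIdeal K G ^ q) ≠ ⊥} with hS
  have hmem : ∀ q, q ∈ S ↔ ∃ M, IsEdgeMultiset G M ∧ (∀ v, edgeDegree M v ≤ c v) ∧ M.card = q := by
    intro q
    rw [hS, Set.mem_ofPred_eq, boundedPart_ne_bot_iff]
    constructor
    · rintro ⟨e, ⟨M, hM, hq, hd⟩, hec⟩
      exact ⟨M, hM, fun v => (hd v).trans_le (hec v), hq⟩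
    · rintro ⟨M, hM, hd, hq⟩
      exact ⟨Finsupp.equivFunOnFinite.symm (edgeDegree M), ⟨M, hM, hq, by simp⟩, by simpa using hd⟩
  -- Without boundedness `sSup` would take its default value 0; twice the number of edges is at most
  -- the total capacity.
  have hbdd : BddAbove S := by
    refine ⟨∑ v, c v, fun q hq => ?_⟩
    obtain ⟨M, hM, hd, rfl⟩ := (hmem q).1 hq
    have h1 := sum_edgeDegree hM
    have h2 : ∑ v, edgeDegree M v ≤ ∑ v, c v := Finset.sum_le_sum fun v _ => hd v
    omega
  have hne : S.Nonempty := ⟨0, (hmem 0).2 ⟨0, by simp [IsEdgeMultiset], by simp, rfl⟩⟩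
  have hδ : delta c (edgeIdeal K G) = sSup S := rfl
  have hin : sSup S ∈ S := Nat.sSup_mem hne hbdd
  unfold W minimalMonomialGenerators
  rw [Set.mem_ofPred_eq, hδ]
  simp only [monomial_mem_boundedPart_iff]
  constructor
  · rintro ⟨⟨e, he, hec, hea⟩, hmin⟩
    have hae : a = e := le_antisymm (hmin ⟨e, he, hec, le_rfl⟩ hea) hea
    subst hae
    obtain ⟨M, hM, hq, hd⟩ := he
    refine ⟨M, ⟨hM, fun v => (hd v).trans_le (hec v), fun N hN hNc => ?_⟩, hd⟩
    rw [hq]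
    exact le_csSup hbdd ((hmem _).2 ⟨N, hN, hNc, rfl⟩)
  · rintro ⟨M, ⟨hM, hMc, hmax⟩, hd⟩
    have hq : M.card = sSup S := by
      refine le_antisymm (le_csSup hbdd ((hmem _).2 ⟨M, hM, hMc, rfl⟩)) ?_
      obtain ⟨N, hN, hNc, hNq⟩ := (hmem _).1 hin
      rw [← hNq]
      exact hmax N hN hNc
    refine ⟨⟨a, ⟨M, hM, hq, hd⟩, fun v => (hd v) ▸ hMc v, le_rfl⟩, ?_⟩
    rintro b ⟨e, ⟨N, hN, hNq, hNd⟩, hec, heb⟩ hba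
    have hea : e ≤ a := heb.trans hba
    -- Both are degree vectors of equally many edges, so divisibility forces equality.
    have hsum : ∑ v, e v = ∑ v, a v := by
      rw [← Finset.sum_congr rfl fun v _ => hNd v, ← Finset.sum_congr rfl fun v _ => hd v,
        sum_edgeDegree hN, sum_edgeDegree hM, hq, hNq]
    have hall := (Finset.sum_eq_sum_iff_of_le fun v _ => hea v).1 hsum
    intro v
    exact (hall v (Finset.mem_univ v)).symm.le.trans (heb v)

end BoundedPowers

/-! ### The two obstructions, and strong exchange in their absence. -/

namespace BoundedPowers

variable {V : Type*}

/-- An independent set `{u₁, u₂, v₁, v₂}` such that `u₁, u₂` have a common neighbour `a`, and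
`v₁, v₂` have a common neighbour `b` adjacent to neither `u₁` nor `u₂`. -/
def HasTwoCherries (G : SimpleGraph V) : Prop :=
  ∃ u₁ u₂ v₁ v₂ a b, u₁ ≠ u₂ ∧ v₁ ≠ v₂ ∧ G.Adj a u₁ ∧ G.Adj a u₂ ∧ G.Adj b v₁ ∧ G.Adj b v₂ ∧
    ¬ G.Adj b u₁ ∧ ¬ G.Adj b u₂ ∧ ¬ G.Adj u₁ u₂ ∧ ¬ G.Adj v₁ v₂ ∧
    ¬ G.Adj u₁ v₁ ∧ ¬ G.Adj u₁ v₂ ∧ ¬ G.Adj u₂ v₁ ∧ ¬ G.Adj u₂ v₂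

/-- A triangle `p, q, r` together with nonadjacent vertices `v₁, v₂` that have a common neighbour
but no neighbour in the triangle. -/
def HasTriangleAndCherry (G : SimpleGraph V) : Prop :=
  ∃ p q r v₁ v₂ a, G.Adj p q ∧ G.Adj q r ∧ G.Adj p r ∧ v₁ ≠ v₂ ∧ G.Adj a v₁ ∧ G.Adj a v₂ ∧
    ¬ G.Adj v₁ v₂ ∧ ¬ G.Adj p v₁ ∧ ¬ G.Adj q v₁ ∧ ¬ G.Adj r v₁ ∧
    ¬ G.Adj p v₂ ∧ ¬ G.Adj q v₂ ∧ ¬ G.Adj r v₂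

/-- Any two triangles have the same vertices. -/
def TrianglesCoincide (G : SimpleGraph V) : Prop :=
  ∀ p q r x y z, G.Adj p q → G.Adj q r → G.Adj p r → G.Adj x y → G.Adj y z → G.Adj x z →
    p = x ∨ p = y ∨ p = z

section Multisets

variable {M N : Multiset (Sym2 V)} {v w : V}

open Classical in
theorem exists_mem_sub_of_lt (h : edgeDegree M v < edgeDegree N v) : ∃ w, s(v, w) ∈ N - M := by
  -- Both sides are the degree in the union `M ∪ N`; this transfers an excess of degree to the
  -- difference.
  have h1 : edgeDegree (N - M + M) v = edgeDegree (M - N + N) v := by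
    rw [← Multiset.union_def, ← Multiset.union_def, Multiset.union_comm]
  rw [edgeDegree_add, edgeDegree_add] at h1
  have h2 : 0 < edgeDegree (N - M) v := by omega
  obtain ⟨e, he, hv⟩ := Multiset.countP_pos.1 h2
  obtain ⟨w, rfl⟩ := Sym2.mem_iff_exists.1 hv
  exact ⟨w, he⟩

open Classical in
theorem exists_mem_sub_of_le (h : edgeDegree M v ≤ edgeDegree N v) (hw : s(v, w) ∈ M - N) :
    ∃ w, s(v, w) ∈ N - M := by
  have h1 : edgeDegree (N - M + M) v = edgeDegree (M - N + N) v := by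
    rw [← Multiset.union_def, ← Multiset.union_def, Multiset.union_comm]
  rw [edgeDegree_add, edgeDegree_add] at h1
  have h3 : 0 < edgeDegree (M - N) v := Multiset.countP_pos.2 ⟨_, hw, by simp⟩
  have h2 : 0 < edgeDegree (N - M) v := by omega
  obtain ⟨e, he, hv⟩ := Multiset.countP_pos.1 h2
  obtain ⟨w, rfl⟩ := Sym2.mem_iff_exists.1 hv
  exact ⟨w, he⟩

variable {α : Type*} [DecidableEq α] {S T : Multiset α} {e f : α}

theorem count_lt_of_mem_sub (h : e ∈ S - T) : T.count e < S.count e := by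
  have := Multiset.count_pos.2 h
  rw [Multiset.count_sub] at this
  omega

/-- Trading `f` for `e` brings `S` one element closer to `T`. This distance is the induction measure
of `exists_exchange`. -/
theorem card_sub_cons_erase_lt (he : e ∈ T - S) (hf : f ∈ S - T) :
    (T - e ::ₘ S.erase f).card < (T - S).card := by
  have h : T - e ::ₘ S.erase f = (T - S).erase e := by
    ext x
    have h1 := count_lt_of_mem_sub he
    have h2 := count_lt_of_mem_sub hf
    by_cases hxe : x = e <;> by_cases hxf : x = f
    · subst hxe hxf; omega
    · subst hxe
      simp [Multiset.count_sub, hxf]; omega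
    · subst hxf
      simp [Multiset.count_sub, hxe]; omega
    · simp [Multiset.count_sub, hxe, hxf]
  rw [h]
  exact Multiset.card_erase_lt_of_mem he

theorem inter_le_cons_erase (hf : f ∈ S - T) : S ∩ T ≤ e ::ₘ S.erase f := by
  refine le_trans ?_ (Multiset.le_cons_self _ _)
  have h2 := count_lt_of_mem_sub hf
  rw [Multiset.le_iff_count]
  intro x
  by_cases hxf : x = f
  · subst hxf; simp; omega
  · simp [hxf]

end Multisets

namespace IsMaxBounded

variable {G : SimpleGraph V} {c : V → ℕ} {M : Multiset (Sym2 V)} {x y z w t : V}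

theorem not_adj (hM : IsMaxBounded G c M) (hx : edgeDegree M x < c x) (hy : edgeDegree M y < c y) :
    ¬ G.Adj x y := by
  classical
  intro h
  have := hM.max (s(x, y) ::ₘ M) ?_ ?_
  · simp at this
  · intro e he
    rcases Multiset.mem_cons.1 he with rfl | he
    exacts [h, hM.edge e he]
  · intro v
    have := hM.le v
    rw [edgeDegree_cons]
    grind

/-- Otherwise `x, y, z, w` is an augmenting path: replacing `yz` by `xy` and `zw` gains an edge. The
ends must differ, since each may have a single spare unit. -/
theorem not_path (hM : IsMaxBounded G c M) (hx : edgeDegree M x < c x) (hw : edgeDegree M w < c w)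
    (hxw : x ≠ w) (hxy : G.Adj x y) (hyz : s(y, z) ∈ M) : ¬ G.Adj z w := by
  intro hzw
  obtain ⟨N, rfl⟩ := Multiset.exists_cons_of_mem hyz
  have hadj : G.Adj y z := hM.edge _ (Multiset.mem_cons_self _ _)
  have := hM.max (s(x, y) ::ₘ s(z, w) ::ₘ N) ?_ ?_
  · simp at this
  · intro e he
    simp only [Multiset.mem_cons] at he
    rcases he with rfl | rfl | he
    exacts [hxy, hzw, hM.edge e (Multiset.mem_cons_of_mem he)]
  · intro v
    have := hM.le v
    have := hxy.ne
    have := hzw.ne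
    have := hadj.ne
    simp only [edgeDegree_cons] at *
    grind

-- The net effect is one unit of degree moved from `z` to `x`; the additive form avoids truncated
-- subtraction.
open Classical in
theorem edgeDegree_swap (hxy : G.Adj x y) (hyz : G.Adj y z) (hM : s(y, z) ∈ M) (v : V) :
    edgeDegree (s(x, y) ::ₘ M.erase s(y, z)) v + (if v = z then 1 else 0) =
      edgeDegree M v + if v = x then 1 else 0 := by
  obtain ⟨N, rfl⟩ := Multiset.exists_cons_of_mem hM
  have := hxy.ne
  have := hyz.ne
  simp only [edgeDegree_cons, Multiset.erase_cons_head]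
  grind

open Classical in
theorem swap (hM : IsMaxBounded G c M) (hxy : G.Adj x y) (hyz : s(y, z) ∈ M)
    (hx : edgeDegree M x < c x) : IsMaxBounded G c (s(x, y) ::ₘ M.erase s(y, z)) where
  edge e he := by
    rcases Multiset.mem_cons.1 he with rfl | he
    exacts [hxy, hM.edge e (Multiset.mem_of_mem_erase he)]
  le v := by
    have h1 := edgeDegree_swap hxy (hM.edge _ hyz) hyz v
    have h2 := hM.le v
    grind
  max N hN hc := by
    rw [Multiset.card_cons, Multiset.card_erase_add_one hyz]
    exact hM.max N hN hc

-- The clause `M ∩ M' ≤ N` strengthens the induction: when the induction hypothesis is applied with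
-- a modified `M'`, it guarantees that the edge needed for the final swap survives in `N`.
open Classical in
theorem exists_exchange (h1 : ¬ HasTwoCherries G) (h2 : ¬ HasTriangleAndCherry G)
    (h3 : TrianglesCoincide G) {M' : Multiset (Sym2 V)} (hM : IsMaxBounded G c M)
    (hM' : IsMaxBounded G c M') {ξ ρ : V} (hξ : edgeDegree M' ξ < edgeDegree M ξ)
    (hρ : edgeDegree M ρ < edgeDegree M' ρ) :
    ∃ N, IsMaxBounded G c N ∧ M ∩ M' ≤ N ∧ ∀ v, edgeDegree N v + (if v = ξ then 1 else 0) =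
      edgeDegree M v + if v = ρ then 1 else 0 := by
  induction hn : (M' - M).card using Nat.strong_induction_on generalizing M M' ξ ρ with
  | _ n ih =>
  subst hn
  have hρc : edgeDegree M ρ < c ρ := hρ.trans_le (hM'.le ρ)
  have hξc : edgeDegree M' ξ < c ξ := hξ.trans_le (hM.le ξ)
  have hξρ : ξ ≠ ρ := by rintro rfl; omega
  -- An alternating walk `ρ, y, z` with first edge from `M' - M` and second from `M - M'`;
  -- maximality of `M` prevents the walk from stopping at `y`.
  obtain ⟨y, hy⟩ := exists_mem_sub_of_lt hρ
  have hyM' : s(ρ, y) ∈ M' := Multiset.mem_of_le (Multiset.sub_le_self _ _) hy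
  have ay : G.Adj ρ y := hM'.edge _ hyM'
  have hdy : edgeDegree M' y ≤ edgeDegree M y := by
    by_contra! h
    exact hM.not_adj hρc (h.trans_le (hM'.le y)) ay
  obtain ⟨z, hz⟩ := exists_mem_sub_of_le hdy (Sym2.eq_swap ▸ hy)
  have hzM : s(y, z) ∈ M := Multiset.mem_of_le (Multiset.sub_le_self _ _) hz
  have az : G.Adj y z := hM.edge _ hzM
  have hzρ : z ≠ ρ := by
    rintro rfl
    rw [Sym2.eq_swap] at hz
    have := count_lt_of_mem_sub hy
    have := count_lt_of_mem_sub hz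
    omega
  have hN := hM.swap ay hzM hρc
  have hNd := edgeDegree_swap ay az hzM
  have hNi : M ∩ M' ≤ _ := inter_le_cons_erase (e := s(ρ, y)) hz
  by_cases hzξ : z = ξ
  · subst hzξ
    exact ⟨_, hN, hNi, hNd⟩
  -- If `z` has no surplus in `M`, the swap leaves it with a deficit, and `z` takes over the role of
  -- `ρ`.
  rcases le_or_gt (edgeDegree M z) (edgeDegree M' z) with hdz | hdz
  · have e1 := hNd ξ
    have e2 := hNd z
    simp only [Ne.symm hzξ, hξρ, hzρ, if_true, if_false] at e1 e2
    obtain ⟨N, hN1, hN3, hN2⟩ := ih _ (card_sub_cons_erase_lt hy hz) hN hM'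
      (ξ := ξ) (ρ := z) (by omega) (by omega) rfl
    exact ⟨N, hN1, (Multiset.le_inter hNi Multiset.inter_le_right).trans hN3,
      fun v => by have := hNd v; have := hN2 v; omega⟩
  -- The mirror walk `ξ, b, t`, with the roles of `M` and `M'` exchanged.
  obtain ⟨b, hb⟩ := exists_mem_sub_of_lt hξ
  have hbM : s(ξ, b) ∈ M := Multiset.mem_of_le (Multiset.sub_le_self _ _) hb
  have ab : G.Adj ξ b := hM.edge _ hbM
  have hdb : edgeDegree M b ≤ edgeDegree M' b := by
    by_contra! h
    exact hM'.not_adj hξc (h.trans_le (hM.le b)) ab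
  obtain ⟨t, ht⟩ := exists_mem_sub_of_le hdb (Sym2.eq_swap ▸ hb)
  have htM' : s(b, t) ∈ M' := Multiset.mem_of_le (Multiset.sub_le_self _ _) ht
  have at' : G.Adj b t := hM'.edge _ htM'
  have htξ : t ≠ ξ := by
    rintro rfl
    rw [Sym2.eq_swap] at ht
    have := count_lt_of_mem_sub hb
    have := count_lt_of_mem_sub ht
    omega
  rw [Sym2.eq_swap] at hb hbM
  by_cases htρ : t = ρ
  · subst htρ
    exact ⟨_, hM.swap at'.symm hbM hρc, inter_le_cons_erase hb, edgeDegree_swap at'.symm ab.symm hbM⟩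
  rcases le_or_gt (edgeDegree M' t) (edgeDegree M t) with hdt | hdt
  · have hM2 := hM'.swap ab htM' hξc
    have hd2 := edgeDegree_swap ab at' htM'
    have e1 := hd2 ρ
    have e2 := hd2 t
    simp only [Ne.symm htρ, Ne.symm hξρ, htξ, if_true, if_false] at e1 e2
    -- The swap in `M'` directly shortens `M - M'`; as the multisets compared have equal cardinality
    -- before and after, the opposite difference shrinks as well.
    have hlt : (s(ξ, b) ::ₘ M'.erase s(b, t) - M).card < (M' - M).card := by
      have h := card_sub_cons_erase_lt (S := M') (T := M) (e := s(ξ, b)) (f := s(b, t))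
        (by rwa [Sym2.eq_swap]) ht
      have k1 := congrArg Multiset.card
        (Multiset.union_def (s(ξ, b) ::ₘ M'.erase s(b, t)) M ▸ Multiset.union_def M _ ▸
          Multiset.union_comm (s(ξ, b) ::ₘ M'.erase s(b, t)) M)
      have k2 := congrArg Multiset.card
        (Multiset.union_def M' M ▸ Multiset.union_def M _ ▸ Multiset.union_comm M' M)
      simp only [Multiset.card_add, Multiset.card_cons, Multiset.card_erase_add_one htM'] at k1 k2
      omega
    -- Here `N` moves a unit from `t` to `ρ`. It still contains `bξ`, which can be traded for `tb`
    -- to move a unit from `ξ` to `t`.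
    obtain ⟨N, hN1, hN3, hN2⟩ := ih _ hlt hM hM2 (ξ := t) (ρ := ρ) (by omega) (by omega) rfl
    have hcb := count_lt_of_mem_sub hb
    have hct := count_lt_of_mem_sub ht
    have hne : s(b, t) ≠ s(b, ξ) := by intro h; rw [h] at hct; omega
    have hcN : Multiset.count s(b, ξ) M' + 1 ≤ Multiset.count s(b, ξ) N := by
      have := Multiset.le_iff_count.1 hN3 s(b, ξ)
      rw [Sym2.eq_swap (a := ξ)] at this
      simp only [Multiset.count_inter, Multiset.count_cons_self,
        Multiset.count_erase_of_ne hne.symm] at this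
      omega
    have hbN : s(b, ξ) ∈ N := Multiset.count_pos.1 (by omega)
    have hdN := edgeDegree_swap at'.symm ab.symm hbN
    refine ⟨_, hN1.swap at'.symm hbN ?_, ?_, fun v => ?_⟩
    · have := hN2 t
      have := hM.le t
      simp only [htρ, if_true, if_false] at *
      omega
    · rw [Multiset.le_iff_count] at hN3 ⊢
      intro x
      have h := hN3 x
      rw [Sym2.eq_swap (a := ξ)] at h
      rw [Sym2.eq_swap (a := t)]
      by_cases hx1 : x = s(b, ξ)
      · subst hx1
        simp only [Multiset.count_inter, Multiset.count_cons_of_ne hne.symm,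
          Multiset.count_erase_self]
        omega
      · by_cases hx2 : x = s(b, t)
        · subst hx2
          simp [hne] at h ⊢
          omega
        · simpa [hx1, hx2] using h
    · have := hdN v
      have := hN2 v
      omega
  -- Now `ρ, t` have spare capacity in `M`, and `ξ, z` have it in `M'`. Every further adjacency
  -- would yield an augmenting path or the desired exchange.
  have htc : edgeDegree M t < c t := hdt.trans_le (hM'.le t)
  have hzc : edgeDegree M' z < c z := hdz.trans_le (hM.le z)
  have nρt : ¬ G.Adj ρ t := hM.not_adj hρc htc
  have nξz : ¬ G.Adj ξ z := hM'.not_adj hξc hzc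
  have nρξ : ¬ G.Adj ρ ξ := fun h =>
    hM.not_path hρc htc (Ne.symm htρ) h (Sym2.eq_swap ▸ hbM) at'
  have nzt : ¬ G.Adj z t := fun h =>
    hM'.not_path hzc hξc hzξ h (Sym2.eq_swap ▸ htM') ab.symm
  by_contra hno
  have nbρ : ¬ G.Adj b ρ := fun h =>
    hno ⟨_, hM.swap h.symm hbM hρc, inter_le_cons_erase hb, edgeDegree_swap h.symm ab.symm hbM⟩
  -- After the swap at `y` the vertex `z` has room, so trading `bξ` for `zb` would complete a
  -- transfer from `ξ` to `ρ`.
  have nbz : ¬ G.Adj b z := by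
    intro h
    have hne : s(b, ξ) ≠ s(y, z) := by
      intro h'
      rcases Sym2.eq_iff.1 h' with ⟨rfl, -⟩ | ⟨rfl, -⟩
      exacts [nbρ ay.symm, h.ne rfl]
    have hbN : s(b, ξ) ∈ s(ρ, y) ::ₘ M.erase s(y, z) :=
      Multiset.mem_cons_of_mem ((Multiset.mem_erase_of_ne hne).2 hbM)
    have hbN' : s(b, ξ) ∈ s(ρ, y) ::ₘ M.erase s(y, z) - M' := by
      have := count_lt_of_mem_sub hb
      rw [← Multiset.count_pos, Multiset.count_sub, Multiset.count_cons,
        Multiset.count_erase_of_ne hne]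
      omega
    have e2 := hNd z
    simp only [hzρ, if_true, if_false] at e2
    have hle := hM.le z
    refine hno ⟨_, hN.swap h.symm hbN (by omega),
      (Multiset.le_inter hNi Multiset.inter_le_right).trans (inter_le_cons_erase hbN'), fun v => ?_⟩
    have := edgeDegree_swap h.symm ab.symm hbN v
    have := hNd v
    omega
  have nyt : G.Adj ρ z → ¬ G.Adj y t := fun h =>
    hM.not_path hρc htc (Ne.symm htρ) h (Sym2.eq_swap ▸ hzM)
  have nyξ : G.Adj ρ z → ¬ G.Adj y ξ := fun h =>
    hM'.not_path hzc hξc hzξ h.symm hyM'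
  have sy : ∀ {p q}, ¬ G.Adj p q → ¬ G.Adj q p := fun h h' => h h'.symm
  -- Each of the triples `ρ, y, z` and `ξ, b, t` is a triangle or a cherry.
  by_cases hρz : G.Adj ρ z <;> by_cases hξt : G.Adj ξ t
  · rcases h3 ρ z y ξ t b hρz az.symm ay hξt at'.symm ab with h | h | rfl
    exacts [hξρ h.symm, htρ h.symm, nρt at']
  · exact h2 ⟨ρ, z, y, ξ, t, b, hρz, az.symm, ay, Ne.symm htξ, ab.symm, at', hξt, nρξ, sy nξz,
      nyξ hρz, nρt, nzt, nyt hρz⟩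
  · exact h2 ⟨ξ, t, b, ρ, z, y, hξt, at'.symm, ab, Ne.symm hzρ, ay.symm, az, hρz, sy nρξ, sy nρt, nbρ,
      nξz, sy nzt, nbz⟩
  · exact h1 ⟨ρ, z, ξ, t, y, b, Ne.symm hzρ, Ne.symm htξ, ay.symm, az, ab.symm, at', nbρ, nbz, hρz,
      hξt, nρξ, nρt, sy nξz, nzt⟩

end IsMaxBounded

theorem enjoysStrongExchange [Finite V] (K : Type*) [Field K] {G : SimpleGraph V}
    (h1 : ¬ HasTwoCherries G) (h2 : ¬ HasTriangleAndCherry G) (h3 : TrianglesCoincide G) :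
    EnjoysStrongExchange K G := by
  classical
  intro c _ a ha b hb ξ ρ hξ hρ
  rw [mem_W_iff] at ha hb ⊢
  obtain ⟨M, hM, hMa⟩ := ha
  obtain ⟨M', hM', hMb⟩ := hb
  obtain ⟨N, hN, -, hNd⟩ := hM.exists_exchange h1 h2 h3 hM' (ξ := ξ) (ρ := ρ)
    (by rwa [hMa, hMb]) (by rwa [hMa, hMb])
  refine ⟨N, hN, fun v => ?_⟩
  have := hNd v
  rw [hMa] at this
  simp only [Finsupp.add_apply, Finsupp.tsub_apply, Finsupp.single_apply]
  grind

end BoundedPowers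

/-! ### Weighted degree counts, and two cherries as an obstruction. -/

namespace BoundedPowers

variable {V : Type*}

open Classical in
theorem EnjoysStrongExchange.exists_exchange [Finite V] {K : Type*} [Field K] {G : SimpleGraph V}
    (h : EnjoysStrongExchange K G) {c : V → ℕ} (hc : ∀ v, 0 < c v) {M M' : Multiset (Sym2 V)}
    (hM : IsMaxBounded G c M) (hM' : IsMaxBounded G c M') {ξ ρ : V}
    (hξ : edgeDegree M' ξ < edgeDegree M ξ) (hρ : edgeDegree M ρ < edgeDegree M' ρ) :
    ∃ N, IsMaxBounded G c N ∧ ∀ v, edgeDegree N v + (if v = ξ then 1 else 0) =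
      edgeDegree M v + if v = ρ then 1 else 0 := by
  have := h c hc (Finsupp.equivFunOnFinite.symm (edgeDegree M)) (mem_W_iff.2 ⟨M, hM, by simp⟩)
    (Finsupp.equivFunOnFinite.symm (edgeDegree M')) (mem_W_iff.2 ⟨M', hM', by simp⟩) ξ ρ
    (by simpa using hξ) (by simpa using hρ)
  obtain ⟨N, hN, hd⟩ := mem_W_iff.1 this
  refine ⟨N, hN, fun v => ?_⟩
  rw [hd]
  simp only [Finsupp.add_apply, Finsupp.tsub_apply, Finsupp.single_apply,
    Finsupp.equivFunOnFinite_symm_apply_apply]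
  grind

section Weights

variable {G : SimpleGraph V}

/-- Weak duality: the inequality for one edge, summed over `M`. Fractional vertex covers `g` thus
bound the size of `M`. -/
theorem sum_mul_edgeDegree_le [Fintype V] {M : Multiset (Sym2 V)} (hM : IsEdgeMultiset G M) {f g : V → ℕ} {k : ℕ}
    (h : ∀ u w, G.Adj u w → f u + f w + k ≤ g u + g w) :
    ∑ v, f v * edgeDegree M v + k * M.card ≤ ∑ v, g v * edgeDegree M v := by
  classical
  induction M using Multiset.induction with
  | empty => simp
  | cons e M ih =>
    induction e with | h u w =>
    have huw : G.Adj u w := hM _ (Multiset.mem_cons_self _ _)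
    have key : ∀ f : V → ℕ, ∑ v, f v * edgeDegree (s(u, w) ::ₘ M) v =
        ∑ v, f v * edgeDegree M v + (f u + f w) := by
      intro f
      have : ∀ v, f v * edgeDegree (s(u, w) ::ₘ M) v = f v * edgeDegree M v +
          ((if v = u then f v else 0) + if v = w then f v else 0) := by
        intro v
        have := huw.ne
        rw [edgeDegree_cons, mul_add]
        grind
      simp [this, Finset.sum_add_distrib]
    have := ih fun e he => hM e (Multiset.mem_cons_of_mem he)
    have := h u w huw
    rw [key, key, Multiset.card_cons, mul_add]
    omega

/-- The edges joining each vertex `x` of `B` to `φ x`. -/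
def choiceEdges (B : Finset V) (φ : V → V) : Multiset (Sym2 V) := B.val.map fun x => s(x, φ x)

theorem card_choiceEdges (B : Finset V) (φ : V → V) : (choiceEdges B φ).card = B.card := by
  simp [choiceEdges]

theorem isEdgeMultiset_choiceEdges {B : Finset V} {φ : V → V} (h : ∀ x ∈ B, G.Adj x (φ x)) :
    IsEdgeMultiset G (choiceEdges B φ) := by
  intro e he
  obtain ⟨x, hx, rfl⟩ := Multiset.mem_map.1 he
  exact h x hx

theorem edgeDegree_choiceEdges [DecidableEq V] {B : Finset V} {φ : V → V} (h : ∀ x ∈ B, φ x ∉ B) (v : V) :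
    edgeDegree (choiceEdges B φ) v = if v ∈ B then 1 else (B.filter (φ · = v)).card := by
  have h1 : edgeDegree (choiceEdges B φ) v = (B.filter fun x => v = x ∨ v = φ x).card := by
    unfold edgeDegree choiceEdges
    rw [Multiset.countP_map]
    simp only [Sym2.mem_iff, Finset.card, Finset.filter]
  rw [h1]
  split_ifs with hv
  · rw [Finset.card_eq_one]
    refine ⟨v, ?_⟩
    ext x
    simp only [Finset.mem_filter, Finset.mem_singleton]
    grind
  · congr 1
    ext x
    simp only [Finset.mem_filter]
    grind

end Weights

/-- Take a maximal independent set `D` containing the four leaves, with capacity 1 off `D` and ample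
capacity on `D`. Assigning each vertex off `D` to a neighbour in `D` gives a maximum multiset. If
all neighbours of `u₁` or `u₂` are assigned to these two, their total degree cannot grow, yet
exchanging `v₁` for `u₂` would increase it. -/
theorem HasTwoCherries.not_enjoysStrongExchange [Finite V] (K : Type*) [Field K]
    {G : SimpleGraph V} (hG : HasTwoCherries G) : ¬ EnjoysStrongExchange K G := by
  classical
  have := Fintype.ofFinite V
  intro hS
  obtain ⟨u₁, u₂, v₁, v₂, a, b, hu, hv, au₁, au₂, bv₁, bv₂, nbu₁, nbu₂, nu, nv, n11, n12, n21, n22⟩ := hG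
  obtain ⟨D, hD, hmax⟩ := Finite.exists_le_maximal (p := fun D : Finset V =>
    ∀ x ∈ D, ∀ y ∈ D, ¬ G.Adj x y) (a := {u₁, u₂, v₁, v₂}) (by simp [G.adj_comm, *])
  have hdom : ∀ x, ∃ y, x ∈ Dᶜ → y ∈ D ∧ G.Adj x y := by
    intro x
    by_contra! h
    have hx := (h x).1
    have hi := hmax.2 (y := insert x D) ?_ (Finset.subset_insert x D)
    · exact absurd (hi (Finset.mem_insert_self x D)) (by simpa using hx)
    · intro y hy z hz hyz
      rcases Finset.mem_insert.1 hy with rfl | hy' <;> rcases Finset.mem_insert.1 hz with rfl | hz'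
      exacts [hyz.ne rfl, (h z).2 hz' hyz, (h y).2 hy' hyz.symm, hmax.1 y hy' z hz' hyz]
  choose ψ hψ using hdom
  have hu₁D : u₁ ∈ D := hD (by simp)
  have hu₂D : u₂ ∈ D := hD (by simp)
  have hv₁D : v₁ ∈ D := hD (by simp)
  have hv₂D : v₂ ∈ D := hD (by simp)
  have hind := hmax.1
  have hadj : ∀ {x y}, x ∈ D → G.Adj y x → y ∈ Dᶜ := fun hx h => by
    rw [Finset.mem_compl]
    exact fun hy => hind _ hy _ hx h
  set c : V → ℕ := fun v => if v ∈ Dᶜ then 1 else Fintype.card V with hc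
  have hV : 0 < Fintype.card V := Fintype.card_pos_iff.2 ⟨a⟩
  have hmaxb : ∀ φ : V → V, (∀ x ∈ Dᶜ, φ x ∈ D ∧ G.Adj x (φ x)) →
      IsMaxBounded G c (choiceEdges Dᶜ φ) := by
    intro φ hφ
    refine ⟨isEdgeMultiset_choiceEdges fun x hx => (hφ x hx).2, fun v => ?_, fun N hN hNc => ?_⟩
    · rw [edgeDegree_choiceEdges fun x hx => by simpa using (hφ x hx).1]
      simp only [hc]
      split_ifs
      · rfl
      · exact Finset.card_le_univ _
    · rw [card_choiceEdges]
      -- The complement of the independent set `D` is a vertex cover.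
      have h := sum_mul_edgeDegree_le hN (f := 0) (g := fun v => if v ∈ Dᶜ then 1 else 0) (k := 1) ?_
      · have h2 : ∑ v, (if v ∈ Dᶜ then 1 else 0) * edgeDegree N v ≤ ∑ v, if v ∈ Dᶜ then 1 else 0 := by
          refine Finset.sum_le_sum fun v _ => ?_
          have := hNc v
          grind
        simp only [Finset.sum_boole, Finset.filter_mem_eq_inter, Finset.univ_inter] at h2
        simp at h h2 ⊢
        omega
      · intro u w huw
        have := hind u
        simp only [Finset.mem_compl, Pi.zero_apply]
        grind
  -- The two assignments differ in the priority between `u₁` and `u₂`, which affects `a`, and in the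
  -- image of `b`, which is adjacent to neither.
  set φ₁ : V → V := fun x => if G.Adj x u₁ then u₁ else if G.Adj x u₂ then u₂ else
    if x = b then v₁ else ψ x with hφ₁
  set φ₂ : V → V := fun x => if G.Adj x u₂ then u₂ else if G.Adj x u₁ then u₁ else
    if x = b then v₂ else ψ x with hφ₂
  have h1 : ∀ x ∈ Dᶜ, φ₁ x ∈ D ∧ G.Adj x (φ₁ x) := by
    intro x hx
    have := hψ x hx
    grind
  have h2 : ∀ x ∈ Dᶜ, φ₂ x ∈ D ∧ G.Adj x (φ₂ x) := by
    intro x hx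
    have := hψ x hx
    grind
  have hne1 : v₁ ≠ u₁ := by rintro rfl; exact nbu₁ bv₁
  have hne2 : v₁ ≠ u₂ := by rintro rfl; exact nbu₂ bv₁
  have hd1 := edgeDegree_choiceEdges (B := Dᶜ) (φ := φ₁) fun x hx => by simpa using (h1 x hx).1
  have hd2 := edgeDegree_choiceEdges (B := Dᶜ) (φ := φ₂) fun x hx => by simpa using (h2 x hx).1
  have hlt1 : edgeDegree (choiceEdges Dᶜ φ₂) v₁ < edgeDegree (choiceEdges Dᶜ φ₁) v₁ := by
    rw [hd1, hd2, if_neg (by simpa using hv₁D), if_neg (by simpa using hv₁D)]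
    refine Finset.card_lt_card (Finset.ssubset_iff_subset_ne.2 ⟨fun x => ?_, fun h => ?_⟩)
    · simp only [Finset.mem_filter]
      grind
    · have : b ∈ Dᶜ.filter (φ₁ · = v₁) := by
        have := hadj hv₁D bv₁
        simp only [Finset.mem_filter]
        grind
      rw [← h] at this
      simp only [Finset.mem_filter] at this
      grind
  have hlt2 : edgeDegree (choiceEdges Dᶜ φ₁) u₂ < edgeDegree (choiceEdges Dᶜ φ₂) u₂ := by
    rw [hd1, hd2, if_neg (by simpa using hu₂D), if_neg (by simpa using hu₂D)]
    refine Finset.card_lt_card (Finset.ssubset_iff_subset_ne.2 ⟨fun x => ?_, fun h => ?_⟩)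
    · have := h1 x
      simp only [Finset.mem_filter]
      grind
    · have : a ∈ Dᶜ.filter (φ₂ · = u₂) := by
        have := hadj hu₁D au₁
        simp only [Finset.mem_filter]
        grind
      rw [← h] at this
      simp only [Finset.mem_filter] at this
      grind
  obtain ⟨N, hN, hNd⟩ := hS.exists_exchange (c := c)
    (fun v => by simp only [hc]; split_ifs <;> omega) (hmaxb φ₁ h1) (hmaxb φ₂ h2) hlt1 hlt2
  -- Every edge at `u₁` or `u₂` has its other end in their joint neighbourhood, whose vertices have
  -- capacity 1.
  have key := sum_mul_edgeDegree_le hN.edge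
    (f := fun v => (if v = u₁ then 1 else 0) + if v = u₂ then 1 else 0)
    (g := fun v => if G.Adj v u₁ ∨ G.Adj v u₂ then 1 else 0) (k := 0) ?_
  · have e1 := hNd u₁
    have e2 := hNd u₂
    simp only [hne1.symm, hne2.symm, hu, if_true, if_false, hd1] at e1 e2
    have hle : ∑ v, (if G.Adj v u₁ ∨ G.Adj v u₂ then 1 else 0) * edgeDegree N v ≤
        ∑ v, if G.Adj v u₁ ∨ G.Adj v u₂ then 1 else 0 := by
      refine Finset.sum_le_sum fun v _ => ?_
      have := hN.le v
      have := @hadj u₁ v hu₁D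
      have := @hadj u₂ v hu₂D
      grind
    have hsum : (Dᶜ.filter (φ₁ · = u₁)).card + (Dᶜ.filter (φ₁ · = u₂)).card =
        ∑ v, if G.Adj v u₁ ∨ G.Adj v u₂ then 1 else 0 := by
      rw [Finset.sum_boole, ← Finset.card_union_of_disjoint]
      · rw [Nat.cast_id]
        congr 1
        ext x
        have := h1 x
        have := @hadj u₁ x hu₁D
        have := @hadj u₂ x hu₂D
        simp only [Finset.mem_union, Finset.mem_filter, Finset.mem_univ, true_and]
        grind
      · rw [Finset.disjoint_left]
        grind
    simp only [add_mul, Finset.sum_add_distrib, ite_mul, one_mul, zero_mul, Finset.sum_ite_eq',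
      Finset.mem_univ, if_true] at key
    simp only [Finset.mem_compl, hu₁D, hu₂D, not_true_eq_false, if_false, ite_mul, one_mul,
      zero_mul] at e1 e2 hle
    omega
  · intro u w huw
    have := huw.symm
    have := huw.ne
    grind

end BoundedPowers

/-! ### A triangle with a distant cherry as an obstruction. -/

namespace BoundedPowers

variable {V : Type*}

-- The triangle receives exactly one spare unit at each vertex, so a maximum multiset uses one
-- triangle edge and wastes one unit. Moving a unit from the triangle to `v₂` wastes two there,
-- which a parity count excludes.
set_option maxHeartbeats 1000000 in
theorem HasTriangleAndCherry.not_enjoysStrongExchange [Finite V] (K : Type*) [Field K]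
    {G : SimpleGraph V} (hG : HasTriangleAndCherry G) : ¬ EnjoysStrongExchange K G := by
  classical
  have := Fintype.ofFinite V
  intro hS
  obtain ⟨p, q, r, v₁, v₂, a, hpq, hqr, hpr, hv, av₁, av₂, nv, np1, nq1, nr1, np2, nq2, nr2⟩ := hG
  obtain ⟨T, hT⟩ : ∃ T : Finset V, T = {p, q, r} := ⟨_, rfl⟩
  have hTmem : ∀ x, x ∈ T ↔ x = p ∨ x = q ∨ x = r := by simp [hT]
  have hTsum : ∀ f : V → ℕ, ∑ t ∈ T, f t = f p + f q + f r := by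
    intro f
    rw [hT, Finset.sum_insert, Finset.sum_insert, Finset.sum_singleton, add_assoc]
    · simpa using hqr.ne
    · simpa using ⟨hpq.ne, hpr.ne⟩
  clear hT
  have far : ∀ v, ¬ G.Adj p v → ¬ G.Adj q v → ¬ G.Adj r v → ∀ t ∈ T, v ≠ t ∧ ¬ G.Adj v t := by
    intro v h1 h2 h3 t ht
    rcases (hTmem t).1 ht with rfl | rfl | rfl
    exacts [⟨by rintro rfl; exact h2 hpq.symm, fun h => h1 h.symm⟩,
      ⟨by rintro rfl; exact h1 hpq, fun h => h2 h.symm⟩,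
      ⟨by rintro rfl; exact h1 hpr, fun h => h3 h.symm⟩]
  obtain ⟨D, hD, ⟨hind, hDT⟩, hmax⟩ := Finite.exists_le_maximal (p := fun D : Finset V =>
    (∀ x ∈ D, ∀ y ∈ D, ¬ G.Adj x y) ∧ ∀ x ∈ D, ∀ t ∈ T, x ≠ t ∧ ¬ G.Adj x t) (a := {v₁, v₂}) (by
      constructor
      · simp [G.adj_comm, *]
      · intro x hx
        rcases Finset.mem_insert.1 hx with rfl | hx
        · exact far _ np1 nq1 nr1
        · rw [Finset.mem_singleton.1 hx]
          exact far _ np2 nq2 nr2)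
  have hv₁D : v₁ ∈ D := hD (by simp)
  have hv₂D : v₂ ∈ D := hD (by simp)
  obtain ⟨B, hB⟩ : ∃ B : Finset V, ∀ x, x ∈ B ↔ x ∉ D ∧ x ∉ T := ⟨(D ∪ T)ᶜ, by simp⟩
  -- By maximality of `D`, a vertex of `B` without neighbours in `D` has one in the triangle.
  have hdom : ∀ x, ∃ y, x ∈ B → G.Adj x y ∧ (y ∈ D ∨ y ∈ T ∧ ∀ d ∈ D, ¬ G.Adj x d) := by
    intro x
    by_contra! h
    have hx := (hB x).1 (h x).1
    have hD' : ∀ d ∈ D, ¬ G.Adj x d := fun d hd hxd => ((h d).2 hxd).1 hd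
    have hi := hmax (y := insert x D) ?_ (Finset.subset_insert x D)
    · exact hx.1 (hi (Finset.mem_insert_self x D))
    · constructor
      · intro y hy z hz hyz
        rcases Finset.mem_insert.1 hy with rfl | hy' <;> rcases Finset.mem_insert.1 hz with rfl | hz'
        exacts [hyz.ne rfl, hD' z hz' hyz, hD' y hy' hyz.symm, hind y hy' z hz' hyz]
      · intro y hy t ht
        rcases Finset.mem_insert.1 hy with rfl | hy'
        · refine ⟨fun h => hx.2 (h ▸ ht), fun hyt => ?_⟩
          obtain ⟨d, hd, hyd⟩ := ((h t).2 hyt).2 ht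
          exact hD' d hd hyd
        · exact hDT y hy' t ht
  choose ψ hψ using hdom
  have haB : a ∈ B := by
    rw [hB, hTmem]
    refine ⟨fun h => hind _ h _ hv₁D av₁, ?_⟩
    rintro (rfl | rfl | rfl)
    exacts [np1 av₁, nq1 av₁, nr1 av₁]
  obtain ⟨A, hA⟩ : ∃ A, A = B.filter (ψ · ∈ D) := ⟨_, rfl⟩
  obtain ⟨Y, hY⟩ : ∃ Y, Y = B.filter (ψ · ∈ T) := ⟨_, rfl⟩
  have hAm : ∀ x, x ∈ A ↔ x ∈ B ∧ ψ x ∈ D := by simp [hA]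
  have hYm : ∀ x, x ∈ Y ↔ x ∈ B ∧ ψ x ∈ T := by simp [hY]
  have hcard : A.card + Y.card = B.card := by
    rw [← Finset.card_union_of_disjoint]
    · congr 1
      ext x
      have := hψ x
      simp only [Finset.mem_union, hAm, hYm]
      tauto
    · rw [Finset.disjoint_left]
      intro x h1 h2
      exact (hDT _ ((hAm x).1 h1).2 _ ((hYm x).1 h2).2).1 rfl
  have hYsum : Y.card = (B.filter (ψ · = p)).card + (B.filter (ψ · = q)).card +
      (B.filter (ψ · = r)).card := by
    rw [← hTsum fun t => (B.filter (ψ · = t)).card,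
      Finset.card_eq_sum_card_fiberwise (f := ψ) (t := T) fun x hx => ((hYm x).1 hx).2]
    refine Finset.sum_congr rfl fun t ht => ?_
    congr 1
    ext x
    simp only [hY, Finset.mem_filter]
    grind
  clear hA hY
  obtain ⟨c, hcB, hcT, hcD⟩ : ∃ c : V → ℕ, (∀ v ∈ B, c v = 1) ∧
      (∀ t ∈ T, c t = 1 + (B.filter (ψ · = t)).card) ∧ ∀ v ∈ D, c v = Fintype.card V := by
    refine ⟨fun v => if v ∈ B then 1 else if v ∈ T then 1 + (B.filter (ψ · = v)).card
      else Fintype.card V, ?_, ?_, ?_⟩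
    · intro v hv
      simp [hv]
    · intro v hv
      have := hB v
      simp [hv, this]
    · intro v hv
      have := hB v
      have : v ∉ T := fun h => (hDT v hv v h).1 rfl
      simp [*]
  have hcpos : ∀ v, 0 < c v := by
    intro v
    have hV : 0 < Fintype.card V := Fintype.card_pos_iff.2 ⟨a⟩
    have := hB v
    by_cases h1 : v ∈ B
    · simp [hcB v h1]
    · by_cases h2 : v ∈ T
      · rw [hcT v h2]; omega
      · rw [hcD v (by tauto)]; exact hV
  have hp : p ∈ T := by simp [hTmem]
  have hq : q ∈ T := by simp [hTmem]
  have hr : r ∈ T := by simp [hTmem]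
  have hbound : ∀ N, IsEdgeMultiset G N → (∀ v, edgeDegree N v ≤ c v) →
      2 * N.card ≤ 2 * A.card + Y.card + (edgeDegree N p + edgeDegree N q + edgeDegree N r) := by
    intro N hN hNc
    -- A half-integral vertex cover, doubled: neighbours of `D` lie in `A`, and edges avoiding `A`
    -- and `D` have both ends in `Y ∪ T`. The degrees on `T` stay explicit for reuse after the
    -- exchange.
    have h := sum_mul_edgeDegree_le hN (f := 0) (g := fun v => (if v ∈ A then 2 else 0) +
      ((if v ∈ Y then 1 else 0) + if v ∈ T then 1 else 0)) (k := 2) ?_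
    · have hA : ∑ v ∈ A, edgeDegree N v ≤ A.card := by
        have := Finset.sum_le_card_nsmul A (edgeDegree N) 1 fun v hv =>
          (hNc v).trans_eq (hcB v ((hAm v).1 hv).1)
        simpa using this
      have hY : ∑ v ∈ Y, edgeDegree N v ≤ Y.card := by
        have := Finset.sum_le_card_nsmul Y (edgeDegree N) 1 fun v hv =>
          (hNc v).trans_eq (hcB v ((hYm v).1 hv).1)
        simpa using this
      simp only [add_mul, Finset.sum_add_distrib, ite_mul, zero_mul, one_mul,
        Finset.sum_ite_mem, Finset.univ_inter, ← Finset.mul_sum, hTsum, Pi.zero_apply,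
        Finset.sum_const_zero] at h
      omega
    · intro u w huw
      have key : ∀ u w, G.Adj u w → u ∈ D → w ∈ A := by
        intro u w huw hu
        have hwB : w ∈ B := (hB w).2 ⟨fun h => hind u hu w h huw, fun h => (hDT u hu w h).2 huw⟩
        refine (hAm w).2 ⟨hwB, ?_⟩
        rcases (hψ w hwB).2 with h | ⟨-, h⟩
        exacts [h, absurd huw.symm (h u hu)]
      have part : ∀ u, u ∈ D ∨ u ∈ A ∨ u ∈ Y ∨ u ∈ T := by
        intro u
        have := hB u
        have := hAm u
        have := hYm u
        have := hψ u
        tauto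
      have h1 := key u w huw
      have h2 := key w u huw.symm
      have h3 := part u
      have h4 := part w
      simp only [Pi.zero_apply]
      clear * - h1 h2 h3 h4
      split_ifs <;> first | omega | (exfalso; tauto)
  have hDB : ∀ v ∈ D, v ∉ B := fun v hv h => ((hB v).1 h).1 hv
  have hTB : ∀ v ∈ T, v ∉ B := fun v hv h => ((hB v).1 h).2 hv
  have hψa : ψ a ∈ D := by
    rcases (hψ a haB).2 with h | ⟨-, h⟩
    exacts [h, absurd av₁ (h _ hv₁D)]
  have hφ : ∀ v ∈ D, G.Adj a v → ∀ x ∈ B, Function.update ψ a v x ∉ B ∧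
      G.Adj x (Function.update ψ a v x) := by
    intro v hv hav x hx
    by_cases hxa : x = a
    · subst hxa
      simpa using ⟨hDB v hv, hav⟩
    · rw [Function.update_of_ne hxa]
      refine ⟨?_, (hψ x hx).1⟩
      rcases (hψ x hx).2 with h | ⟨h, -⟩
      exacts [hDB _ h, hTB _ h]
  have hφT : ∀ v ∈ D, ∀ t ∈ T, B.filter (Function.update ψ a v · = t) = B.filter (ψ · = t) := by
    intro v hv t ht
    refine Finset.filter_congr fun x _ => ?_
    by_cases hxa : x = a
    · subst hxa
      have h1 := (hDT v hv t ht).1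
      have h2 := (hDT _ hψa t ht).1
      simp [h1, h2]
    · rw [Function.update_of_ne hxa]
  have hdeg : ∀ v ∈ D, G.Adj a v → ∀ y z w, edgeDegree (s(y, z) ::ₘ choiceEdges B (Function.update ψ a v)) w =
      (if w ∈ B then 1 else (B.filter (Function.update ψ a v · = w)).card) +
        if w = y ∨ w = z then 1 else 0 := by
    intro v hv hav y z w
    rw [edgeDegree_cons, edgeDegree_choiceEdges fun x hx => (hφ v hv hav x hx).1]
  have hmaxb : ∀ v ∈ D, G.Adj a v → ∀ y ∈ T, ∀ z ∈ T, G.Adj y z →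
      IsMaxBounded G c (s(y, z) ::ₘ choiceEdges B (Function.update ψ a v)) := by
    intro v hv hav y hy z hz hyz
    refine ⟨?_, fun w => ?_, fun N hN hNc => ?_⟩
    · intro e he
      rcases Multiset.mem_cons.1 he with rfl | he
      exacts [hyz, isEdgeMultiset_choiceEdges (fun x hx => (hφ v hv hav x hx).2) e he]
    · rw [hdeg v hv hav]
      by_cases hwB : w ∈ B
      · have h1 : w ≠ y := fun h => hTB y hy (h ▸ hwB)
        have h2 : w ≠ z := fun h => hTB z hz (h ▸ hwB)
        simp [hwB, h1, h2, hcB w hwB]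
      · by_cases hwT : w ∈ T
        · rw [if_neg hwB, hφT v hv w hwT, hcT w hwT]
          split_ifs <;> omega
        · have hwD : w ∈ D := by
            have := hB w
            tauto
          have h1 : w ≠ y := (hDT w hwD y hy).1
          have h2 : w ≠ z := (hDT w hwD z hz).1
          rw [if_neg hwB, hcD w hwD]
          simpa [h1, h2] using Finset.card_le_univ _
    · have h1 := hbound N hN hNc
      have h2 := hNc p
      have h3 := hNc q
      have h4 := hNc r
      rw [hcT p hp] at h2
      rw [hcT q hq] at h3
      rw [hcT r hr] at h4
      rw [Multiset.card_cons, card_choiceEdges]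
      omega
  -- One multiset uses `qr` and sends `a` to `v₁`, the other uses `pr` and sends `a` to `v₂`. After
  -- the exchange `p` and `q` both lack their spare unit.
  obtain ⟨N, hN, hNd⟩ := hS.exists_exchange hcpos (hmaxb v₁ hv₁D av₁ q hq r hr hqr)
    (hmaxb v₂ hv₂D av₂ p hp r hr hpr) (ξ := q) (ρ := v₂) (by
      rw [hdeg v₁ hv₁D av₁, hdeg v₂ hv₂D av₂, if_neg (hTB q hq), hφT _ hv₁D q hq, hφT _ hv₂D q hq]
      simp [hpq.ne.symm, hqr.ne, hTB q hq]) (by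
      have h1 := (hDT v₂ hv₂D p hp).1
      have h2 := (hDT v₂ hv₂D q hq).1
      have h3 := (hDT v₂ hv₂D r hr).1
      rw [hdeg v₁ hv₁D av₁, hdeg v₂ hv₂D av₂, if_neg (hDB _ hv₂D), if_neg (hDB _ hv₂D)]
      simp only [h1, h2, h3, or_self, if_false, add_zero]
      refine Finset.card_lt_card (Finset.ssubset_iff_of_subset (fun x => ?_) |>.2 ⟨a, ?_, ?_⟩)
      · by_cases hxa : x = a
        · subst hxa
          simp [hv]
        · simp [Function.update_of_ne hxa]
      · simp [haB]
      · simp [hv])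
  have e1 := hNd p
  have e2 := hNd q
  have e3 := hN.le r
  have h1 := (hDT v₂ hv₂D p hp).1.symm
  have h2 := (hDT v₂ hv₂D q hq).1.symm
  rw [hdeg v₁ hv₁D av₁, if_neg (hTB p hp), hφT _ hv₁D p hp] at e1
  rw [hdeg v₁ hv₁D av₁, if_neg (hTB q hq), hφT _ hv₁D q hq] at e2
  rw [hcT r hr] at e3
  simp only [hpq.ne, hpr.ne, h1, h2, or_self, true_or, if_true, if_false, add_zero] at e1 e2
  have e4 := hbound N hN.edge hN.le
  have e5 := hN.max _ (hmaxb v₁ hv₁D av₁ q hq r hr hqr).edge (hmaxb v₁ hv₁D av₁ q hq r hr hqr).le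
  rw [Multiset.card_cons, card_choiceEdges] at e5
  omega

end BoundedPowers

/-! ### Unicyclic graphs as cycles with rooted trees. -/

namespace BoundedPowers

open SimpleGraph

variable {V : Type*} {G : SimpleGraph V}

theorem cycleGraph_adj_iff_val {n : ℕ} (hn : 3 ≤ n) {i j : Fin n} :
    (cycleGraph n).Adj i j ↔ (i.val = j.val + 1 ∨ j.val + 1 = n ∧ i.val = 0) ∨
      (j.val = i.val + 1 ∨ i.val + 1 = n ∧ j.val = 0) := by
  have key : ∀ i j : Fin n, (i - j).val = 1 ↔ i.val = j.val + 1 ∨ j.val + 1 = n ∧ i.val = 0 := by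
    intro i j
    have := i.isLt
    have := j.isLt
    rw [Fin.sub_def]
    simp only
    rcases lt_or_ge i.val j.val with h | h
    · rw [Nat.mod_eq_of_lt (by omega)]
      omega
    · rw [show n - j.val + i.val = (i.val - j.val) + n by omega, Nat.add_mod_right,
        Nat.mod_eq_of_lt (by omega)]
      omega
  rw [cycleGraph_adj', key, key]

/-- `G` consists of an induced cycle `c`, and of trees attached to it: `h` is the distance to the
cycle, and every edge outside the cycle joins a vertex `v` off the cycle to its parent `par v`. -/
structure IsCycleWithTrees (G : SimpleGraph V) {n : ℕ} (c : Fin n → V) (h : V → ℕ) (par : V → V) :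
    Prop where
  inj : Function.Injective c
  height_eq_zero : ∀ v, h v = 0 ↔ ∃ i, c i = v
  adj_par : ∀ v, h v ≠ 0 → G.Adj v (par v)
  height_par : ∀ v, h v ≠ 0 → h (par v) + 1 = h v
  adj_cycle : ∀ i j, G.Adj (c i) (c j) ↔ (cycleGraph n).Adj i j
  adj : ∀ u v, G.Adj u v → (h u = 0 ∧ h v = 0) ∨ (h u ≠ 0 ∧ v = par u) ∨ (h v ≠ 0 ∧ u = par v)

/-- A cycle through `e` would be a second cycle subgraph. -/
theorem IsUnicyclic.isBridge (hG : IsUnicyclic G) {x : V} {C : G.Walk x x} (hC : C.IsCycle)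
    {e : Sym2 V} (he : e ∈ G.edgeSet) (heC : e ∉ C.edges) : G.IsBridge e := by
  rw [isBridge_iff_forall_cycle_notMem he]
  intro w p hp hep
  refine heC ?_
  obtain ⟨S, -, hS⟩ := hG.2
  have h1 : p.toSubgraph = S := hS _ ⟨w, p, hp, rfl⟩
  have h2 : C.toSubgraph = S := hS _ ⟨x, C, hC, rfl⟩
  rw [← Walk.mem_edges_toSubgraph, h2, ← h1, Walk.mem_edges_toSubgraph]
  exact hep

/-- The height is the distance to `S`, and the parent is the next vertex on a shortest walk. -/
theorem exists_height (hG : G.Connected) (S : Set V) (hS : S.Nonempty) :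
    ∃ h : V → ℕ, ∃ par : V → V, (∀ v, h v = 0 ↔ v ∈ S) ∧
      ∀ v, h v ≠ 0 → G.Adj v (par v) ∧ h (par v) + 1 = h v := by
  classical
  obtain ⟨s, hs⟩ := hS
  have hex : ∀ v, ∃ k, ∃ w ∈ S, ∃ p : G.Walk v w, p.length = k := fun v =>
    (hG v s).elim fun p => ⟨_, s, hs, p, rfl⟩
  have hpar : ∀ v, ∃ w, Nat.find (hex v) ≠ 0 → G.Adj v w ∧ Nat.find (hex w) + 1 = Nat.find (hex v) := by
    intro v
    obtain ⟨w, hw, p, hp⟩ := Nat.find_spec (hex v)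
    cases p with
    | nil => exact ⟨v, fun h => absurd hp.symm h⟩
    | cons hadj q =>
      rename_i u
      refine ⟨u, fun _ => ⟨hadj, ?_⟩⟩
      have h1 : Nat.find (hex u) ≤ q.length := Nat.find_min' _ ⟨w, hw, q, rfl⟩
      obtain ⟨w', hw', q', hq'⟩ := Nat.find_spec (hex u)
      have h2 : Nat.find (hex v) ≤ (Walk.cons hadj q').length := Nat.find_min' _ ⟨w', hw', _, rfl⟩
      rw [Walk.length_cons] at hp h2
      omega
  choose par hpar using hpar
  refine ⟨fun v => Nat.find (hex v), par, fun v => ?_, hpar⟩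
  rw [Nat.find_eq_zero]
  constructor
  · rintro ⟨w, hw, p, hp⟩
    rwa [Walk.eq_of_length_eq_zero hp]
  · exact fun hv => ⟨v, hv, Walk.nil, rfl⟩

theorem IsUnicyclic.exists_isCycleWithTrees (hG : IsUnicyclic G) {x : V} {C : G.Walk x x}
    (hC : C.IsCycle) : ∃ (c : Fin C.length → V) (h : V → ℕ) (par : V → V),
      IsCycleWithTrees G c h par := by
  classical
  have hlen := hC.three_le_length
  obtain ⟨h, par, h0, hpar⟩ := exists_height hG.1 {v | v ∈ C.support} ⟨x, C.start_mem_support⟩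
  -- Parent edges followed by cycle edges lead to `x`, so an edge of neither kind could not be a
  -- bridge.
  have hreach : ∀ e, e ∉ C.edges → (∀ v, h v ≠ 0 → e ≠ s(v, par v)) →
      ∀ v, (G.deleteEdges {e}).Reachable v x := by
    intro e he hne v
    induction hk : h v using Nat.strong_induction_on generalizing v with
    | _ k ih =>
    by_cases hv : h v = 0
    · have hvC : v ∈ C.support := (h0 v).1 hv
      induction e with | h a b =>
      rw [reachable_deleteEdges_iff_exists_walk]
      refine ⟨(C.takeUntil v hvC).reverse, fun hmem => he ?_⟩
      rw [Walk.edges_reverse, List.mem_reverse] at hmem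
      exact C.edges_takeUntil_subset_edges hvC hmem
    · obtain ⟨h1, h2⟩ := hpar v hv
      have hadj : (G.deleteEdges {e}).Adj v (par v) := by
        rw [deleteEdges_adj]
        exact ⟨h1, fun h => hne v hv h.symm⟩
      exact hadj.reachable.trans (ih _ (by omega) (par v) rfl)
  have hedge : ∀ u v, G.Adj u v → s(u, v) ∈ C.edges ∨ (h u ≠ 0 ∧ v = par u) ∨ (h v ≠ 0 ∧ u = par v) := by
    intro u v huv
    by_contra! hcon
    obtain ⟨h1, h2, h3⟩ := hcon
    have hb := hG.isBridge hC (G.mem_edgeSet.2 huv) h1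
    rw [isBridge_iff] at hb
    have hr := hreach s(u, v) h1 fun w hw heq => by
      rcases Sym2.eq_iff.1 heq with ⟨rfl, h⟩ | ⟨h, rfl⟩
      exacts [h2 hw h, h3 hw h]
    exact hb ((hr u).trans (hr v).symm)
  have hinj : Function.Injective fun i : Fin C.length => C.getVert i := by
    intro i j hij
    exact Fin.ext (hC.getVert_injOn' (by rw [Set.mem_ofPred_eq]; omega)
      (by rw [Set.mem_ofPred_eq]; omega) hij)
  have hh0 : ∀ v, h v = 0 ↔ ∃ i : Fin C.length, C.getVert i = v := by
    intro v
    rw [h0, Set.mem_ofPred_eq, Walk.mem_support_iff_exists_getVert]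
    constructor
    · rintro ⟨n, rfl, hn⟩
      rcases hn.lt_or_eq with hn | rfl
      · exact ⟨⟨n, hn⟩, rfl⟩
      · exact ⟨⟨0, by omega⟩, by simp⟩
    · rintro ⟨i, rfl⟩
      exact ⟨i, rfl, i.isLt.le⟩
  refine ⟨fun i => C.getVert i, h, par, hinj, hh0, fun v hv => (hpar v hv).1,
    fun v hv => (hpar v hv).2, fun i j => ?_, fun u v huv => ?_⟩
  · rw [cycleGraph_adj_iff_val hlen]
    have step : ∀ i j : Fin C.length, (i.val = j.val + 1 ∨ j.val + 1 = C.length ∧ i.val = 0) →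
        G.Adj (C.getVert j) (C.getVert i) := by
      intro i j hij
      have := C.adj_getVert_succ j.isLt
      rcases hij with hij | ⟨h1, h2⟩
      · rwa [hij]
      · rw [h1, Walk.getVert_length] at this
        rwa [h2, Walk.getVert_zero]
    constructor
    · intro hadj
      rcases hedge _ _ hadj with h1 | h1 | h1
      · rw [Walk.mk_mem_edges_iff_exists] at h1
        obtain ⟨k, hk, heq⟩ := h1
        have aux : ∀ i j : Fin C.length, C.getVert k = C.getVert i → C.getVert (k + 1) = C.getVert j →
            (j.val = i.val + 1 ∨ i.val + 1 = C.length ∧ j.val = 0) := by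
          intro i j h1 h2
          have e1 : (⟨k, hk⟩ : Fin C.length) = i := hinj h1
          subst e1
          rcases (show k + 1 ≤ C.length from hk).lt_or_eq with hk' | hk'
          · have e2 : (⟨k + 1, hk'⟩ : Fin C.length) = j := hinj h2
            subst e2
            exact Or.inl rfl
          · rw [hk', Walk.getVert_length] at h2
            have e2 : (⟨0, by omega⟩ : Fin C.length) = j := hinj (C.getVert_zero.trans h2)
            subst e2
            exact Or.inr ⟨hk', rfl⟩
        rcases Sym2.eq_iff.1 heq with ⟨h1, h2⟩ | ⟨h1, h2⟩
        exacts [Or.inr (aux _ _ h1 h2), Or.inl (aux _ _ h1 h2)]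
      · exact absurd ((hh0 _).2 ⟨i, rfl⟩) h1.1
      · exact absurd ((hh0 _).2 ⟨j, rfl⟩) h1.1
    · rintro (h1 | h1)
      exacts [(step _ _ h1).symm, step _ _ h1]
  · rcases hedge u v huv with h1 | h1
    · exact Or.inl ⟨(h0 u).2 (C.fst_mem_support_of_mem_edges h1),
        (h0 v).2 (C.snd_mem_support_of_mem_edges h1)⟩
    · exact Or.inr h1

end BoundedPowers

/-! ### Recognising attached paths; triangles. -/

namespace BoundedPowers

open SimpleGraph

variable {V : Type*} {G : SimpleGraph V}

namespace IsCycleWithTrees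

variable {n : ℕ} {c : Fin n → V} {h : V → ℕ} {par : V → V}

theorem height_cycle (hT : IsCycleWithTrees G c h par) (i : Fin n) : h (c i) = 0 :=
  (hT.height_eq_zero _).2 ⟨i, rfl⟩

theorem not_adj (hT : IsCycleWithTrees G c h par) {v w : V} (hv : h v ≠ 0) (hvw : h w ≤ h v)
    (hp : par v ≠ w) : ¬ G.Adj v w := by
  intro hadj
  rcases hT.adj v w hadj with h1 | h1 | h1
  · exact hv h1.1
  · exact hp h1.2.symm
  · have := hT.height_par w h1.1
    rw [← h1.2] at this
    omega

theorem exists_height_eq (hT : IsCycleWithTrees G c h par) {k : ℕ} {v : V} (hk : k ≤ h v) :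
    ∃ w, h w = k := by
  induction hm : h v - k generalizing v with
  | zero => exact ⟨v, by omega⟩
  | succ m ih =>
    have := hT.height_par v (by omega)
    exact ih (v := par v) (by omega) (by omega)

theorem exists_par_eq (hT : IsCycleWithTrees G c h par) {v : V} (hv : h v = 1) :
    ∃ i, par v = c i := by
  have := hT.height_par v (by omega)
  obtain ⟨i, hi⟩ := (hT.height_eq_zero (par v)).1 (by omega)
  exact ⟨i, hi.symm⟩

theorem height_eq_of_par (hT : IsCycleWithTrees G c h par) {v w : V} {k : ℕ} (hv : h v ≠ 0)
    (hw : par v = w) (hk : h w = k) : h v = k + 1 := by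
  have := hT.height_par v hv
  rw [hw] at this
  omega

theorem adj_of_par (hT : IsCycleWithTrees G c h par) {v w : V} (hv : h v ≠ 0) (hw : par v = w) :
    G.Adj w v := hw ▸ (hT.adj_par v hv).symm

/-- Here `y i j` is the vertex of height `j + 1` on the `i`-th path. Parents determine everything
below, so distinctness is needed only at height one. -/
theorem nonempty_iso_attachPaths (hT : IsCycleWithTrees G c h par) {ι : Type*} (r : ι → Fin n)
    (L : ι → ℕ) (y : ι → ℕ → V) (hy : ∀ i j, j < L i → h (y i j) = j + 1)
    (hroot : ∀ i, 0 < L i → par (y i 0) = c (r i))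
    (hstep : ∀ i j, j + 1 < L i → par (y i (j + 1)) = y i j)
    (hinj : ∀ i i', 0 < L i → 0 < L i' → y i 0 = y i' 0 → i = i')
    (hsurj : ∀ v, h v ≠ 0 → ∃ i j, j < L i ∧ y i j = v) :
    Nonempty (G ≃g attachPaths (cycleGraph n) r L) := by
  have hyinj : ∀ j i i', j < L i → j < L i' → y i j = y i' j → i = i' := by
    intro j
    induction j with
    | zero => exact hinj
    | succ j ih =>
      intro i i' hi hi' he
      refine ih i i' (by omega) (by omega) ?_
      rw [← hstep i j hi, ← hstep i' j hi', he]
  let φ : Fin n ⊕ (Σ i, Fin (L i)) → V := Sum.elim c fun q => y q.1 q.2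
  have h2 : ∀ q : Σ i, Fin (L i), h (y q.1 q.2) = q.2.val + 1 := fun q => hy q.1 q.2 q.2.isLt
  have hφ : Function.Bijective φ := by
    constructor
    · rintro (i | q) (i' | q') he
      · exact congrArg _ (hT.inj he)
      · have e1 := hT.height_cycle i
        have e2 := h2 q'
        rw [show c i = y q'.1 q'.2 from he] at e1
        omega
      · have e1 := hT.height_cycle i'
        have e2 := h2 q
        rw [show y q.1 q.2 = c i' from he] at e2
        omega
      · have he : y q.1 q.2 = y q'.1 q'.2 := he
        have e1 := h2 q
        have e2 := h2 q'
        rw [he] at e1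
        obtain ⟨i, j, hj⟩ := q
        obtain ⟨i', j', hj'⟩ := q'
        simp only at *
        obtain rfl : j = j' := by omega
        obtain rfl := hyinj j i i' hj hj' he
        rfl
    · intro v
      by_cases hv : h v = 0
      · obtain ⟨i, hi⟩ := (hT.height_eq_zero v).1 hv
        exact ⟨Sum.inl i, hi⟩
      · obtain ⟨i, j, hj, he⟩ := hsurj v hv
        exact ⟨Sum.inr ⟨i, j, hj⟩, he⟩
  have hmix : ∀ u (q : Σ i, Fin (L i)), G.Adj (c u) (y q.1 q.2) ↔ u = r q.1 ∧ (q.2 : ℕ) = 0 := by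
    rintro u ⟨i, j, hj⟩
    simp only
    have e1 := hy i j hj
    have e2 := hT.height_cycle u
    constructor
    · intro hadj
      rcases hT.adj _ _ hadj with h1 | h1 | h1
      · omega
      · omega
      · have e3 := hT.height_par _ h1.1
        rw [← h1.2] at e3
        obtain rfl : j = 0 := by omega
        rw [hroot i hj] at h1
        exact ⟨hT.inj h1.2, rfl⟩
    · rintro ⟨rfl, rfl⟩
      exact hT.adj_of_par (by omega) (hroot i hj)
  have hcons : ∀ q q' : Σ i, Fin (L i), q.1 = q'.1 → (q.2 : ℕ) + 1 = q'.2 →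
      G.Adj (y q.1 q.2) (y q'.1 q'.2) := by
    rintro ⟨i, j, hj⟩ ⟨i', j', hj'⟩ he he'
    simp only at he he' ⊢
    subst he he'
    exact hT.adj_of_par (by rw [hy i _ hj']; omega) (hstep i j hj')
  have hcons' : ∀ q q' : Σ i, Fin (L i), h (y q'.1 q'.2) ≠ 0 → y q.1 q.2 = par (y q'.1 q'.2) →
      q.1 = q'.1 ∧ (q.2 : ℕ) + 1 = q'.2 := by
    rintro ⟨i, j, hj⟩ ⟨i', j', hj'⟩ he he'
    simp only at he he' ⊢
    have e1 := hT.height_par _ he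
    rw [← he', hy i j hj, hy i' j' hj'] at e1
    obtain rfl : j' = j + 1 := by omega
    rw [hstep i' j hj'] at he'
    exact ⟨hyinj j i i' hj (by omega) he', rfl⟩
  refine ⟨(RelIso.mk (Equiv.ofBijective φ hφ) ?_ : attachPaths (cycleGraph n) r L ≃g G).symm⟩
  rintro (u | q) (u' | q')
  · exact hT.adj_cycle u u'
  · exact hmix u q'
  · rw [G.adj_comm]
    exact hmix u' q
  · change G.Adj (y q.1 q.2) (y q'.1 q'.2) ↔
      q.1 = q'.1 ∧ ((q.2 : ℕ) + 1 = (q'.2 : ℕ) ∨ (q'.2 : ℕ) + 1 = (q.2 : ℕ))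
    constructor
    · intro hadj
      rcases hT.adj _ _ hadj with h1 | h1 | h1
      · have := h2 q
        omega
      · obtain ⟨e1, e2⟩ := hcons' q' q h1.1 h1.2
        exact ⟨e1.symm, Or.inr e2⟩
      · obtain ⟨e1, e2⟩ := hcons' q q' h1.1 h1.2
        exact ⟨e1, Or.inl e2⟩
    · rintro ⟨e1, e2 | e2⟩
      exacts [hcons q q' e1 e2, (hcons q' q e1.symm e2).symm]

theorem rotate {c : Fin 4 → V} (hT : IsCycleWithTrees G c h par) (s : Fin 4) :
    IsCycleWithTrees G (fun i => c (s + i)) h par where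
  inj i j hij := by simpa using hT.inj hij
  height_eq_zero v := by
    rw [hT.height_eq_zero]
    exact ⟨fun ⟨i, hi⟩ => ⟨i - s, by simpa using hi⟩, fun ⟨i, hi⟩ => ⟨_, hi⟩⟩
  adj_par := hT.adj_par
  height_par := hT.height_par
  adj_cycle i j := by
    rw [hT.adj_cycle]
    revert s i j
    decide
  adj := hT.adj

/-- A highest vertex off the cycle would have two neighbours that are not higher, but only its
parent qualifies. -/
theorem height_eq_zero_of_triangle (hT : IsCycleWithTrees G c h par) {p q r : V} (hpq : G.Adj p q)
    (hqr : G.Adj q r) (hpr : G.Adj p r) : h p = 0 ∧ h q = 0 ∧ h r = 0 := by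
  have h1 := hT.adj _ _ hpq
  have h2 := hT.adj _ _ hqr
  have h3 := hT.adj _ _ hpr
  have h4 := hpq.ne
  have h5 := hqr.ne
  have h6 := hpr.ne
  have h7 := hT.height_par p
  have h8 := hT.height_par q
  have h9 := hT.height_par r
  grind

theorem trianglesCoincide (hT : IsCycleWithTrees G c h par) (hn : n = 3) : TrianglesCoincide G := by
  subst hn
  intro p q r x y z hpq hqr hpr hxy hyz hxz
  obtain ⟨⟨i, rfl⟩, -, -⟩ := (hT.height_eq_zero_of_triangle hpq hqr hpr).imp
    (hT.height_eq_zero _).1 id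
  obtain ⟨h1, h2, h3⟩ := hT.height_eq_zero_of_triangle hxy hyz hxz
  obtain ⟨a, rfl⟩ := (hT.height_eq_zero _).1 h1
  obtain ⟨b, rfl⟩ := (hT.height_eq_zero _).1 h2
  obtain ⟨d, rfl⟩ := (hT.height_eq_zero _).1 h3
  have e1 : a ≠ b := fun h => hxy.ne (congrArg c h)
  have e2 : b ≠ d := fun h => hyz.ne (congrArg c h)
  have e3 : a ≠ d := fun h => hxz.ne (congrArg c h)
  have : i = a ∨ i = b ∨ i = d := by omega
  exact this.imp (congrArg c) (Or.imp (congrArg c) (congrArg c))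

theorem not_triangle (hT : IsCycleWithTrees G c h par) (hn : 4 ≤ n) {p q r : V} (hpq : G.Adj p q)
    (hqr : G.Adj q r) : ¬ G.Adj p r := by
  intro hpr
  obtain ⟨h1, h2, h3⟩ := hT.height_eq_zero_of_triangle hpq hqr hpr
  obtain ⟨a, rfl⟩ := (hT.height_eq_zero _).1 h1
  obtain ⟨b, rfl⟩ := (hT.height_eq_zero _).1 h2
  obtain ⟨d, rfl⟩ := (hT.height_eq_zero _).1 h3
  rw [hT.adj_cycle, cycleGraph_adj_iff_val (by omega)] at hpq hqr hpr
  omega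

end IsCycleWithTrees

end BoundedPowers

/-! ### Two cherries in cycles of length at least four with trees. -/

namespace BoundedPowers

open SimpleGraph

variable {V : Type*} {G : SimpleGraph V}

namespace IsCycleWithTrees

variable {n : ℕ} {c : Fin n → V} {h : V → ℕ} {par : V → V}

theorem not_adj_cycle (hT : IsCycleWithTrees G c h par) {v : V} {i : Fin n} (hv : h v ≠ 0)
    (hp : par v ≠ c i) : ¬ G.Adj v (c i) :=
  hT.not_adj hv (by rw [hT.height_cycle]; omega) hp

theorem cycle_not_adj (hT : IsCycleWithTrees G c h par) {v : V} {i : Fin n} (hv : h v ≠ 0)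
    (hp : par v ≠ c i) : ¬ G.Adj (c i) v :=
  fun h' => hT.not_adj_cycle hv hp h'.symm

theorem not_adj_cycle_of_two_le (hT : IsCycleWithTrees G c h par) {v : V} (i : Fin n)
    (hv : 2 ≤ h v) : ¬ G.Adj v (c i) := by
  refine hT.not_adj_cycle (by omega) fun h1 => ?_
  have h2 := hT.height_par v (by omega)
  rw [h1, hT.height_cycle] at h2
  omega

theorem not_adj_of_height_eq (hT : IsCycleWithTrees G c h par) {v w : V} (hv : h v ≠ 0)
    (hvw : h v = h w) : ¬ G.Adj v w := by
  refine hT.not_adj hv hvw.ge fun h1 => ?_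
  have h2 := hT.height_par v hv
  rw [h1] at h2
  omega

theorem not_adj_of_height_lt (hT : IsCycleWithTrees G c h par) {v w : V}
    (hvw : h v + 1 < h w) : ¬ G.Adj v w := fun h' => by
  refine hT.not_adj (by omega) (by omega) (fun h1 => ?_) h'.symm
  have h2 := hT.height_par w (by omega)
  rw [h1] at h2
  omega

theorem cycle_not_adj_of_ne {c : Fin n → V} (hT : IsCycleWithTrees G c h par) {i j : Fin n}
    (hij : ¬ (cycleGraph n).Adj i j) : ¬ G.Adj (c i) (c j) := by rwa [hT.adj_cycle]

/-- Two vertices with a common neighbour, away from a path of length two on the cycle. -/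
theorem hasTwoCherries_of_path (hT : IsCycleWithTrees G c h par) {p q r : Fin n}
    (hpq : (cycleGraph n).Adj p q) (hqr : (cycleGraph n).Adj q r) (hpr : ¬ (cycleGraph n).Adj p r)
    (hne : p ≠ r) {u₁ u₂ a : V} (hu : u₁ ≠ u₂) (hn : ¬ G.Adj u₁ u₂) (h1 : G.Adj a u₁)
    (h2 : G.Adj a u₂) (hu₁ : ∀ i, i = p ∨ i = q ∨ i = r → ¬ G.Adj u₁ (c i))
    (hu₂ : ∀ i, i = p ∨ i = q ∨ i = r → ¬ G.Adj u₂ (c i)) : HasTwoCherries G :=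
  ⟨u₁, u₂, c p, c r, a, c q, hu, hT.inj.ne hne, h1, h2, (hT.adj_cycle _ _).2 hpq.symm,
    (hT.adj_cycle _ _).2 hqr, fun h => hu₁ q (by simp) h.symm, fun h => hu₂ q (by simp) h.symm, hn,
    hT.cycle_not_adj_of_ne hpr, hu₁ p (by simp), hu₁ r (by simp), hu₂ p (by simp), hu₂ r (by simp)⟩

/-- The cherries are `0, 1, 2` and `4, 5, 6`; vertices 3 and 7 separate them, whence the bound. -/
theorem hasTwoCherries_of_eight_le (hT : IsCycleWithTrees G c h par) (hn : 8 ≤ n) :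
    HasTwoCherries G := by
  refine hT.hasTwoCherries_of_path (p := ⟨4, by omega⟩) (q := ⟨5, by omega⟩) (r := ⟨6, by omega⟩)
    (u₁ := c ⟨0, by omega⟩) (u₂ := c ⟨2, by omega⟩) (a := c ⟨1, by omega⟩) ?_ ?_ ?_ ?_ ?_ ?_ ?_ ?_ ?_ ?_
  all_goals simp only [hT.adj_cycle, hT.inj.eq_iff, cycleGraph_adj_iff_val (show 3 ≤ n by omega),
    ne_eq, Fin.ext_iff]
  all_goals first
    | omega
    | simp

/-- Around every vertex of the cycle there is room for an induced path of length two. -/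
def HasOppositePaths (n : ℕ) : Prop :=
  ∀ i : Fin n, ∃ p q r : Fin n, (cycleGraph n).Adj p q ∧ (cycleGraph n).Adj q r ∧
    ¬ (cycleGraph n).Adj p r ∧ p ≠ r ∧ ∀ j, j = p ∨ j = q ∨ j = r → i ≠ j

theorem hasOppositePaths_four : HasOppositePaths 4 := fun i =>
  ⟨i + 1, i + 2, i + 3, by revert i; decide⟩

theorem hasOppositePaths_five : HasOppositePaths 5 := fun i =>
  ⟨i + 1, i + 2, i + 3, by revert i; decide⟩

theorem eq_of_height_one (hT : IsCycleWithTrees G c h par) (hn : HasOppositePaths n)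
    (hG : ¬ HasTwoCherries G) {u v : V} (hu : h u = 1) (hv : h v = 1) (hp : par u = par v) :
    u = v := by
  by_contra hne
  obtain ⟨i, hi⟩ := hT.exists_par_eq hu
  obtain ⟨p, q, r, h1, h2, h3, h4, h5⟩ := hn i
  refine hG (hT.hasTwoCherries_of_path h1 h2 h3 h4 hne (hT.not_adj_of_height_eq (by omega) (by omega))
    (hT.adj_of_par (by omega) hi) (hT.adj_of_par (by omega) (hp ▸ hi)) ?_ ?_)
  · exact fun j hj => hT.not_adj_cycle (by omega) (by rw [hi]; exact hT.inj.ne (h5 j hj))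
  · exact fun j hj => hT.not_adj_cycle (by omega) (by rw [← hp, hi]; exact hT.inj.ne (h5 j hj))

theorem eq_of_height_two (hT : IsCycleWithTrees G c h par) (hn : HasOppositePaths n)
    (hG : ¬ HasTwoCherries G) {u v : V} (hu : h u = 2) (hv : h v = 2) (hp : par u = par v) :
    u = v := by
  by_contra hne
  obtain ⟨i, -⟩ := (hT.height_eq_zero (par (par u))).1 (by
    have := hT.height_par u (by omega)
    have := hT.height_par (par u) (by omega)
    omega)
  obtain ⟨p, q, r, h1, h2, h3, h4, -⟩ := hn i
  exact hG (hT.hasTwoCherries_of_path h1 h2 h3 h4 hne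
    (hT.not_adj_of_height_eq (by omega) (by omega)) (hT.adj_of_par (by omega) rfl)
    (hT.adj_of_par (by omega) hp.symm) (fun j _ => hT.not_adj_cycle_of_two_le j hu.ge)
    fun j _ => hT.not_adj_cycle_of_two_le j hv.ge)

/-- A vertex of height three and its grandparent form a cherry that touches the cycle only at the
root. -/
theorem height_le_two (hT : IsCycleWithTrees G c h par) (hn : HasOppositePaths n)
    (hG : ¬ HasTwoCherries G) (v : V) : h v ≤ 2 := by
  by_contra! hv
  obtain ⟨w, hw⟩ := hT.exists_height_eq (k := 3) hv
  have e1 := hT.height_par w (by omega)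
  have e2 := hT.height_par (par w) (by omega)
  obtain ⟨i, hi⟩ := hT.exists_par_eq (v := par (par w)) (by omega)
  obtain ⟨p, q, r, h1, h2, h3, h4, h5⟩ := hn i
  refine hG (hT.hasTwoCherries_of_path h1 h2 h3 h4 (u₁ := par (par w)) (u₂ := w) (a := par w) ?_
    (hT.not_adj_of_height_lt (by omega)) (hT.adj_par _ (by omega)) (hT.adj_of_par (by omega) rfl) ?_
    fun j _ => hT.not_adj_cycle_of_two_le j (by omega))
  · intro h
    rw [h] at e2
    omega
  · exact fun j hj => hT.not_adj_cycle (by omega) (by rw [hi]; exact hT.inj.ne (h5 j hj))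

theorem height_eq_zero_of_six_seven (hT : IsCycleWithTrees G c h par) (hn : n = 6 ∨ n = 7)
    (hG : ¬ HasTwoCherries G) (v : V) : h v = 0 := by
  by_contra hv
  obtain ⟨w, hw⟩ := hT.exists_height_eq (k := 1) (v := v) (by omega)
  obtain ⟨i, hi⟩ := hT.exists_par_eq hw
  -- The pendant vertex and the next cycle vertex form one cherry; three consecutive cycle vertices
  -- out of their reach form the other.
  have key : ∃ k p q r : Fin n, (cycleGraph n).Adj i k ∧ (cycleGraph n).Adj p q ∧
      (cycleGraph n).Adj q r ∧ ¬ (cycleGraph n).Adj p r ∧ p ≠ r ∧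
      ∀ j, j = p ∨ j = q ∨ j = r → i ≠ j ∧ ¬ (cycleGraph n).Adj k j := by
    rcases hn with rfl | rfl
    · exact ⟨i + 1, i + 3, i + 4, i + 5, by clear hi; revert i; decide⟩
    · exact ⟨i + 1, i + 3, i + 4, i + 5, by clear hi; revert i; decide⟩
  obtain ⟨k, p, q, r, h0, h1, h2, h3, h4, h5⟩ := key
  refine hG (hT.hasTwoCherries_of_path h1 h2 h3 h4 (u₁ := w) (u₂ := c k) (a := c i) ?_ ?_
    (hT.adj_of_par (by omega) hi) ((hT.adj_cycle _ _).2 h0) ?_ ?_)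
  · rintro rfl
    rw [hT.height_cycle] at hw
    omega
  · exact hT.not_adj_cycle (by omega) (by rw [hi]; exact hT.inj.ne h0.ne)
  · exact fun j hj => hT.not_adj_cycle (by omega) (by rw [hi]; exact hT.inj.ne (h5 j hj).1)
  · exact fun j hj => hT.cycle_not_adj_of_ne (h5 j hj).2

/-- Pendant edges at two different vertices `i`, `j` of the cycle. -/
theorem hasTwoCherries_of_two_roots (hT : IsCycleWithTrees G c h par) {i j k m : Fin n} {y z : V}
    (hy : h y = 1) (hz : h z = 1) (hyi : par y = c i) (hzj : par z = c j) (hij : i ≠ j)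
    (hki : (cycleGraph n).Adj i k) (hmj : (cycleGraph n).Adj j m) (hkj : ¬ (cycleGraph n).Adj j k)
    (hkm : ¬ (cycleGraph n).Adj k m) (hk : k ≠ j) (hm : m ≠ i) : HasTwoCherries G := by
  have ne : ∀ {w : V} {i : Fin n}, h w = 1 → w ≠ c i := by
    rintro w i hw rfl
    rw [hT.height_cycle] at hw
    omega
  refine ⟨y, c k, z, c m, c i, c j, ne hy, ne hz, hT.adj_of_par (by omega) hyi,
    (hT.adj_cycle _ _).2 hki, hT.adj_of_par (by omega) hzj, (hT.adj_cycle _ _).2 hmj,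
    hT.cycle_not_adj (by omega) ?_, hT.cycle_not_adj_of_ne hkj, hT.not_adj_cycle (by omega) ?_,
    hT.not_adj_cycle (by omega) ?_, hT.not_adj_of_height_eq (by omega) (by omega),
    hT.not_adj_cycle (by omega) ?_, hT.cycle_not_adj (by omega) ?_, hT.cycle_not_adj_of_ne hkm⟩
  · rw [hyi]; exact hT.inj.ne hij
  · rw [hyi]; exact hT.inj.ne hki.ne
  · rw [hzj]; exact hT.inj.ne hmj.ne
  · rw [hyi]; exact hT.inj.ne hm.symm
  · rw [hzj]; exact hT.inj.ne hk.symm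

theorem eq_of_height_one_of_five {c : Fin 5 → V} (hT : IsCycleWithTrees G c h par)
    (hG : ¬ HasTwoCherries G) {u v : V} (hu : h u = 1) (hv : h v = 1) : u = v := by
  obtain ⟨i, hi⟩ := hT.exists_par_eq hu
  obtain ⟨j, hj⟩ := hT.exists_par_eq hv
  by_cases hij : i = j
  · exact hT.eq_of_height_one hasOppositePaths_five hG hu hv (by rw [hi, hj, hij])
  · have : ∀ i j : Fin 5, i ≠ j → ∃ k m, (cycleGraph 5).Adj i k ∧ (cycleGraph 5).Adj j m ∧
        ¬ (cycleGraph 5).Adj j k ∧ ¬ (cycleGraph 5).Adj k m ∧ k ≠ j ∧ m ≠ i := by decide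
    obtain ⟨k, m, h1, h2, h3, h4, h5, h6⟩ := this i j hij
    exact absurd (hT.hasTwoCherries_of_two_roots hu hv hi hj hij h1 h2 h3 h4 h5 h6) hG

/-- The cherries are `z, c k` centred at `c j` and `c i, y` centred at `par y`. The centre `c j` is
adjacent to `c i`, which the asymmetric condition on centres in `HasTwoCherries` permits. -/
theorem par_ne_of_height_two_of_adj {c : Fin 4 → V} (hT : IsCycleWithTrees G c h par)
    (hG : ¬ HasTwoCherries G) {i j : Fin 4} {y z : V} (hy : h y = 2) (hyi : par (par y) = c i)
    (hz : h z = 1) (hij : (cycleGraph 4).Adj i j) : par z ≠ c j := by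
  intro hzj
  have e1 := hT.height_par y (by omega)
  have : ∀ i j : Fin 4, (cycleGraph 4).Adj i j → ∃ k, (cycleGraph 4).Adj j k ∧ k ≠ i ∧
      ¬ (cycleGraph 4).Adj k i := by decide
  obtain ⟨k, h1, h2, h3⟩ := this i j hij
  have hpy : par y ≠ z := by
    rintro rfl
    exact hT.inj.ne hij.ne (hyi.symm.trans hzj)
  refine hG ⟨z, c k, c i, y, c j, par y, ?_, ?_, hT.adj_of_par (by omega) hzj,
    (hT.adj_cycle _ _).2 h1, ?_, hT.adj_of_par (by omega) rfl,
    hT.not_adj_of_height_eq (by omega) (by omega), hT.not_adj_cycle (by omega) ?_,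
    hT.not_adj_cycle (by omega) ?_, fun h => hT.not_adj_cycle_of_two_le i hy.ge h.symm,
    hT.not_adj_cycle (by omega) ?_, fun h => hT.not_adj (by omega) (by omega) hpy h.symm,
    hT.cycle_not_adj_of_ne h3, fun h => hT.not_adj_cycle_of_two_le k hy.ge h.symm⟩
  · rintro rfl; rw [hT.height_cycle] at hz; omega
  · rintro rfl; rw [hT.height_cycle] at hy; omega
  · exact (hT.adj_of_par (by omega) hyi).symm
  · rw [hyi]; exact hT.inj.ne h2.symm
  · rw [hzj]; exact hT.inj.ne h1.ne
  · rw [hzj]; exact hT.inj.ne hij.ne.symm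

theorem par_par_eq_of_height_two {c : Fin 4 → V} (hT : IsCycleWithTrees G c h par)
    (hG : ¬ HasTwoCherries G) {y z : V} (hy : h y = 2) (hz : h z = 2) :
    par (par y) = par (par z) := by
  have e1 := hT.height_par y (by omega)
  have e2 := hT.height_par z (by omega)
  obtain ⟨i, hi⟩ := hT.exists_par_eq (v := par y) (by omega)
  obtain ⟨j, hj⟩ := hT.exists_par_eq (v := par z) (by omega)
  by_contra hne
  have hij : i ≠ j := by
    rintro rfl
    exact hne (hi.trans hj.symm)
  by_cases hadj : (cycleGraph 4).Adj i j
  · exact hT.par_ne_of_height_two_of_adj hG hy hi (by omega) hadj hj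
  · have hyz : par y ≠ par z := fun h => hne (by rw [h])
    refine hG ⟨c i, y, c j, z, par y, par z, ?_, ?_, (hT.adj_of_par (by omega) hi).symm,
      hT.adj_of_par (by omega) rfl, (hT.adj_of_par (by omega) hj).symm,
      hT.adj_of_par (by omega) rfl, hT.not_adj_cycle (by omega) ?_,
      fun h => hT.not_adj (by omega) (by omega) hyz h.symm,
      fun h => hT.not_adj_cycle_of_two_le i hy.ge h.symm,
      fun h => hT.not_adj_cycle_of_two_le j hz.ge h.symm, hT.cycle_not_adj_of_ne hadj,
      fun h => hT.not_adj_cycle_of_two_le i hz.ge h.symm, hT.not_adj_cycle_of_two_le j hy.ge,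
      hT.not_adj_of_height_eq (by omega) (by omega)⟩
    · rintro rfl; rw [hT.height_cycle] at hy; omega
    · rintro rfl; rw [hT.height_cycle] at hz; omega
    · rw [hj]; exact hT.inj.ne hij.symm

end IsCycleWithTrees

end BoundedPowers

/-! ### Independence numbers for lengths 5, 6, 7, and the list for length 4. -/

namespace BoundedPowers

open SimpleGraph

variable {V : Type*} {G : SimpleGraph V}

theorem HasTwoCherries.four_le_indepNum [Finite V] (hG : HasTwoCherries G) : 4 ≤ G.indepNum := by
  classical
  have := Fintype.ofFinite V
  obtain ⟨u₁, u₂, v₁, v₂, a, b, hu, hv, -, -, b1, b2, nb1, nb2, n1, n2, n11, n12, n21, n22⟩ := hG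
  have e11 : u₁ ≠ v₁ := by rintro rfl; exact nb1 b1
  have e12 : u₁ ≠ v₂ := by rintro rfl; exact nb1 b2
  have e21 : u₂ ≠ v₁ := by rintro rfl; exact nb2 b1
  have e22 : u₂ ≠ v₂ := by rintro rfl; exact nb2 b2
  have hs : G.IsIndepSet (({u₁, u₂, v₁, v₂} : Finset V) : Set V) := by
    intro x hx y hy _
    simp only [Finset.coe_insert, Finset.coe_singleton, Set.mem_insert_iff,
      Set.mem_singleton_iff] at hx hy
    rcases hx with rfl | rfl | rfl | rfl <;> rcases hy with rfl | rfl | rfl | rfl <;>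
      first
        | exact G.irrefl
        | assumption
        | exact fun h => absurd h.symm (by assumption)
  have := hs.card_le_indepNum
  rwa [Finset.card_insert_of_notMem (by simp [hu, e11, e12]),
    Finset.card_insert_of_notMem (by simp [e21, e22]), Finset.card_pair hv] at this

namespace IsCycleWithTrees

variable {n : ℕ} {c : Fin n → V} {h : V → ℕ} {par : V → V}

/-- The trace of an independent set on the cycle is disjoint from its shift by one. -/
theorem two_mul_card_le [DecidableEq V] (hT : IsCycleWithTrees G c h par) (hn : 3 ≤ n)
    {s : Finset V} (hs : G.IsIndepSet s) : 2 * (s.filter (h · = 0)).card ≤ n := by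
  obtain ⟨n, rfl⟩ : ∃ m, n = m + 1 := ⟨n - 1, by omega⟩
  set t : Finset (Fin (n + 1)) := Finset.univ.filter (c · ∈ s) with ht
  have h1 : (s.filter (h · = 0)).card = t.card := by
    rw [← Finset.card_image_of_injective t hT.inj]
    congr 1
    ext v
    simp only [Finset.mem_filter, hT.height_eq_zero, Finset.mem_image, ht, Finset.mem_univ, true_and]
    constructor
    · rintro ⟨hv, i, rfl⟩
      exact ⟨i, hv, rfl⟩
    · rintro ⟨i, hi, rfl⟩
      exact ⟨hi, i, rfl⟩
  have h2 : Disjoint t (t.image (finRotate (n + 1))) := by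
    rw [Finset.disjoint_left]
    intro i hi hi'
    obtain ⟨j, hj, rfl⟩ := Finset.mem_image.1 hi'
    have hadj : (cycleGraph (n + 1)).Adj j (finRotate (n + 1) j) := by
      rw [cycleGraph_adj_iff_val hn]
      rcases eq_or_ne j (Fin.last n) with rfl | hj
      · rw [finRotate_last]
        simp
      · rw [coe_finRotate_of_ne_last hj]
        omega
    have := (hT.adj_cycle _ _).2 hadj
    simp only [ht, Finset.mem_filter, Finset.mem_univ, true_and] at hi hj
    exact hs hj hi this.ne this
  have h3 := Finset.card_union_of_disjoint h2
  rw [Finset.card_image_of_injective t (finRotate (n + 1)).injective] at h3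
  have h4 := Finset.card_le_univ (t ∪ t.image (finRotate (n + 1)))
  rw [Fintype.card_fin] at h4
  omega

/-- For `n = 5` the cycle contributes at most two vertices, and what lies off it is at most an edge.
For `n = 6, 7` nothing lies off the cycle. -/
theorem indepNum_le_three [Finite V] (hT : IsCycleWithTrees G c h par) (hn : n = 5 ∨ n = 6 ∨ n = 7)
    (hG : ¬ HasTwoCherries G) : G.indepNum ≤ 3 := by
  classical
  have := Fintype.ofFinite V
  obtain ⟨s, hs⟩ := G.exists_isNIndepSet_indepNum
  rw [← hs.card_eq]
  have h1 := hT.two_mul_card_le (by omega) hs.isIndepSet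
  have h2 := Finset.card_filter_add_card_filter_not (s := s) (h · = 0)
  suffices (s.filter (¬ h · = 0)).card ≤ 1 ∧ (n ≠ 5 → (s.filter (¬ h · = 0)).card = 0) by omega
  constructor
  · rw [Finset.card_le_one]
    intro u hu v hv
    rw [Finset.mem_filter] at hu hv
    rcases hn with rfl | hn
    · have key : ∀ u v, h u = 1 → h v = 2 → G.Adj u v := by
        intro u v hu hv
        have := hT.height_par v (by omega)
        exact hT.adj_of_par (by omega) (hT.eq_of_height_one_of_five hG (by omega) hu)
      have hu2 := hT.height_le_two hasOppositePaths_five hG u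
      have hv2 := hT.height_le_two hasOppositePaths_five hG v
      by_contra hne
      rcases (show h u = 1 ∨ h u = 2 by omega) with hu' | hu' <;>
        rcases (show h v = 1 ∨ h v = 2 by omega) with hv' | hv'
      · exact hne (hT.eq_of_height_one_of_five hG hu' hv')
      · exact hs.isIndepSet hu.1 hv.1 hne (key u v hu' hv')
      · exact hs.isIndepSet hu.1 hv.1 hne (key v u hv' hu').symm
      · have e1 := hT.height_par u hu.2
        have e2 := hT.height_par v hv.2
        exact hne (hT.eq_of_height_two hasOppositePaths_five hG hu' hv'
          (hT.eq_of_height_one_of_five hG (by omega) (by omega)))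
    · exact absurd (hT.height_eq_zero_of_six_seven hn hG u) hu.2
  · intro h5
    rw [Finset.card_eq_zero, Finset.filter_eq_empty_iff]
    intro v _
    exact not_not.2 (hT.height_eq_zero_of_six_seven (by omega) hG v)

theorem iso_of_four {c : Fin 4 → V} (hT : IsCycleWithTrees G c h par) (hG : ¬ HasTwoCherries G) :
    (∃ L : Fin 4 → ℕ, (∀ i, L i ≤ 1) ∧
      Nonempty (G ≃g attachPaths (cycleGraph 4) (fun i => i) L)) ∨
    Nonempty (G ≃g attachPaths (cycleGraph 4) (fun i => i) ![2, 0, 1, 0]) ∨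
    ∃ v : Fin 4, Nonempty (G ≃g attachPaths (cycleGraph 4) (fun _ : Fin 1 => v) (fun _ => 2)) := by
  classical
  have hle := hT.height_le_two hasOppositePaths_four hG
  by_cases h2 : ∃ y, h y = 2
  · right
    obtain ⟨y, hy⟩ := h2
    have e1 := hT.height_par y (by omega)
    obtain ⟨i, hi⟩ := hT.exists_par_eq (v := par y) (by omega)
    have hy2 : ∀ v, h v = 2 → v = y := by
      intro v hv
      have e2 := hT.height_par v (by omega)
      exact hT.eq_of_height_two hasOppositePaths_four hG hv hy
        (hT.eq_of_height_one hasOppositePaths_four hG (by omega) (by omega)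
          (hT.par_par_eq_of_height_two hG hv hy))
    have hcases : ∀ i j : Fin 4, j = i ∨ j = i + 2 ∨ (cycleGraph 4).Adj i j := by decide
    have h1 : ∀ v, h v = 1 → v = par y ∨ par v = c (i + 2) := by
      intro v hv
      obtain ⟨j, hj⟩ := hT.exists_par_eq hv
      rcases hcases i j with rfl | rfl | hij
      · exact Or.inl (hT.eq_of_height_one hasOppositePaths_four hG hv (by omega) (hj.trans hi.symm))
      · exact Or.inr hj
      · exact absurd hj (hT.par_ne_of_height_two_of_adj hG hy hi hv hij)
    by_cases hz : ∃ z, h z = 1 ∧ par z = c (i + 2)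
    · left
      obtain ⟨z, hz, hzi⟩ := hz
      -- The rotation puts the path of length two at index 0 and the pendant edge at index 2; the
      -- entries for the empty paths are arbitrary.
      refine (hT.rotate i).nonempty_iso_attachPaths _ _
        ![fun j => if j = 0 then par y else y, fun _ => y, fun _ => z, fun _ => y] ?_ ?_ ?_ ?_ ?_
      · intro a j hj
        fin_cases a <;> simp at hj ⊢
        · rcases (show j = 0 ∨ j = 1 by omega) with rfl | rfl
          · simp; omega
          · simpa using hy
        · simpa [hj] using hz
      · intro a ha
        fin_cases a <;> simp at ha ⊢
        · exact hi
        · exact hzi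
      · intro a j hj
        fin_cases a <;> simp at hj ⊢
        simp [hj]
      · intro a b ha hb hab
        have hne : par y ≠ z := by
          rintro rfl
          have hi2 : ∀ i : Fin 4, i ≠ i + 2 := by decide
          exact hi2 i (hT.inj (hi.symm.trans hzi))
        fin_cases a <;> fin_cases b <;> simp at ha hb hab ⊢
        exacts [hne hab, hne hab.symm]
      · intro v hv
        have := hle v
        rcases (show h v = 1 ∨ h v = 2 by omega) with hv | hv
        · rcases h1 v hv with rfl | hv'
          · exact ⟨0, 0, by simp, by simp⟩
          · exact ⟨2, 0, by simp, (hT.eq_of_height_one hasOppositePaths_four hG hz hv (hzi.trans hv'.symm))⟩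
        · exact ⟨0, 1, by simp, by simp [hy2 v hv]⟩
    · right
      refine ⟨i, hT.nonempty_iso_attachPaths _ _ (fun _ j => if j = 0 then par y else y) ?_ ?_ ?_ ?_ ?_⟩
      · intro a j hj
        rcases (show j = 0 ∨ j = 1 by omega) with rfl | rfl
        · simp; omega
        · simpa using hy
      · intro a ha
        simpa using hi
      · intro a j hj
        obtain rfl : j = 0 := by omega
        simp
      · intro a b _ _ _
        exact Subsingleton.elim a b
      · intro v hv
        have := hle v
        rcases (show h v = 1 ∨ h v = 2 by omega) with hv | hv
        · rcases h1 v hv with rfl | hv'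
          · exact ⟨0, 0, by simp, by simp⟩
          · exact absurd ⟨v, hv, hv'⟩ hz
        · exact ⟨0, 1, by simp, by simp [hy2 v hv]⟩
  · left
    have hone : ∀ v, h v ≠ 0 → h v = 1 := by
      intro v hv
      have := hle v
      by_contra hne
      exact h2 ⟨v, by omega⟩
    have hch : ∀ i, ∃ y, (∃ v, h v = 1 ∧ par v = c i) → h y = 1 ∧ par y = c i := by
      intro i
      by_cases hv : ∃ v, h v = 1 ∧ par v = c i
      · exact hv.imp fun v hv _ => hv
      · exact ⟨c i, fun h => absurd h hv⟩
    choose ch hch using hch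
    refine ⟨fun i => if ∃ v, h v = 1 ∧ par v = c i then 1 else 0, fun i => by dsimp only; split_ifs <;> omega,
      hT.nonempty_iso_attachPaths _ _ (fun i _ => ch i) ?_ ?_ ?_ ?_ ?_⟩
    · intro i j hj
      split_ifs at hj with hv
      · rw [(hch i hv).1]; omega
      · omega
    · intro i hi
      split_ifs at hi with hv
      · exact (hch i hv).2
      · omega
    · intro i j hj
      split_ifs at hj <;> omega
    · intro i j hi hj hij
      split_ifs at hi with hvi
      · split_ifs at hj with hvj
        · have := (hch i hvi).2
          rw [hij, (hch j hvj).2] at this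
          exact (hT.inj this).symm
        · omega
      · omega
    · intro v hv
      have hv1 := hone v hv
      obtain ⟨i, hi⟩ := hT.exists_par_eq hv1
      have hex : ∃ v, h v = 1 ∧ par v = c i := ⟨v, hv1, hi⟩
      refine ⟨i, 0, by simp only [if_pos hex]; omega, ?_⟩
      exact hT.eq_of_height_one hasOppositePaths_four hG (hch i hex).1 hv1 ((hch i hex).2.trans hi.symm)

end IsCycleWithTrees

end BoundedPowers

/-! ### The list for length 3. -/

namespace BoundedPowers

open SimpleGraph

variable {V : Type*} {G : SimpleGraph V}

namespace IsCycleWithTrees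

variable {c : Fin 3 → V} {h : V → ℕ} {par : V → V}

theorem adj_triangle (hT : IsCycleWithTrees G c h par) {i j : Fin 3} (hij : i ≠ j) :
    G.Adj (c i) (c j) := by
  rw [hT.adj_cycle, cycleGraph_three_eq_top, top_adj]
  exact hij

/-- Vertices of height at least two have no neighbour on the cycle, which is itself the triangle.
Hence branching is possible only on the cycle. -/
theorem hasTriangleAndCherry (hT : IsCycleWithTrees G c h par) {v₁ v₂ a : V} (h1 : 2 ≤ h v₁)
    (h2 : 2 ≤ h v₂) (hv : v₁ ≠ v₂) (ha₁ : G.Adj a v₁) (ha₂ : G.Adj a v₂) (hn : ¬ G.Adj v₁ v₂) :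
    HasTriangleAndCherry G := by
  have n1 : ∀ i, ¬ G.Adj (c i) v₁ := fun i h => hT.not_adj_cycle_of_two_le i h1 h.symm
  have n2 : ∀ i, ¬ G.Adj (c i) v₂ := fun i h => hT.not_adj_cycle_of_two_le i h2 h.symm
  exact ⟨c 0, c 1, c 2, v₁, v₂, a, hT.adj_triangle (by decide), hT.adj_triangle (by decide),
    hT.adj_triangle (by decide), hv, ha₁, ha₂, hn, n1 0, n1 1, n1 2, n2 0, n2 1, n2 2⟩

theorem eq_of_two_le_height (hT : IsCycleWithTrees G c h par) (hG : ¬ HasTriangleAndCherry G)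
    {u v : V} (hu : 2 ≤ h u) (hv : 2 ≤ h v) (hp : par u = par v) : u = v := by
  have e1 := hT.height_par u (by omega)
  have e2 := hT.height_par v (by omega)
  rw [hp] at e1
  by_contra hne
  exact hG (hT.hasTriangleAndCherry hu hv hne (hT.adj_of_par (by omega) hp)
    (hT.adj_of_par (by omega) rfl) (hT.not_adj_of_height_eq (by omega) (by omega)))

theorem height_le_three (hT : IsCycleWithTrees G c h par) (hG : ¬ HasTriangleAndCherry G) (v : V) :
    h v ≤ 3 := by
  by_contra! hv
  obtain ⟨w, hw⟩ := hT.exists_height_eq (k := 4) hv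
  have e1 := hT.height_par w (by omega)
  have e2 := hT.height_par (par w) (by omega)
  refine hG (hT.hasTriangleAndCherry (v₁ := par (par w)) (v₂ := w) (a := par w) (by omega) (by omega)
    ?_ (hT.adj_par _ (by omega)) (hT.adj_of_par (by omega) rfl) (hT.not_adj_of_height_lt (by omega)))
  intro h
  rw [h] at e2
  omega

theorem ne_cycle (hT : IsCycleWithTrees G c h par) {v : V} (hv : h v ≠ 0) (i : Fin 3) :
    v ≠ c i := by
  rintro rfl
  exact hv (hT.height_cycle i)

/-- Otherwise `z` with a free triangle vertex and `y` with its grandparent form two cherries. -/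
theorem eq_par_par_of_height_three (hT : IsCycleWithTrees G c h par) (hG : ¬ HasTwoCherries G)
    {y z : V} (hy : h y = 3) (hz : h z = 1) : z = par (par y) := by
  by_contra hne
  have e1 := hT.height_par y (by omega)
  have e2 := hT.height_par (par y) (by omega)
  obtain ⟨i, hi⟩ := hT.exists_par_eq (v := par (par y)) (by omega)
  obtain ⟨j, hj⟩ := hT.exists_par_eq hz
  have hk : ∀ i j : Fin 3, ∃ k, k ≠ i ∧ k ≠ j := by decide
  obtain ⟨k, hki, hkj⟩ := hk i j
  have ny : y ≠ par (par y) := fun h => by rw [← h] at e2; omega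
  have n1 : ¬ G.Adj (par y) z := hT.not_adj (by omega) (by omega) (Ne.symm hne)
  have n2 : ¬ G.Adj (par (par y)) z := hT.not_adj_of_height_eq (by omega) (by omega)
  have n3 : ¬ G.Adj y z := fun h => hT.not_adj_of_height_lt (by omega) h.symm
  have n4 : ¬ G.Adj (par (par y)) (c k) :=
    hT.not_adj_cycle (by omega) (by rw [hi]; exact hT.inj.ne hki.symm)
  have n5 : ¬ G.Adj z (c k) := hT.not_adj_cycle (by omega) (by rw [hj]; exact hT.inj.ne hkj.symm)
  exact hG ⟨z, c k, par (par y), y, c j, par y, hT.ne_cycle (by omega) k, ny.symm,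
    hT.adj_of_par (by omega) hj, hT.adj_triangle hkj.symm, hT.adj_par _ (by omega),
    hT.adj_of_par (by omega) rfl, n1, hT.not_adj_cycle_of_two_le k (by omega), n5,
    hT.not_adj_of_height_lt (by omega), fun h => n2 h.symm, fun h => n3 h.symm, fun h => n4 h.symm,
    fun h => hT.not_adj_cycle_of_two_le k (by omega) h.symm⟩

/-- Otherwise the siblings form one cherry, and `z` with the third triangle vertex the other. -/
theorem par_eq_of_siblings (hT : IsCycleWithTrees G c h par) (hG : ¬ HasTwoCherries G) {y y' z : V}
    (hy : h y = 1) (hy' : h y' = 1) (hyy : y ≠ y') (hp : par y = par y') (hz : h z = 1) :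
    par z = par y := by
  obtain ⟨i, hi⟩ := hT.exists_par_eq hy
  obtain ⟨j, hj⟩ := hT.exists_par_eq hz
  by_contra hne
  have hij : i ≠ j := by
    rintro rfl
    exact hne (hj.trans hi.symm)
  have hk : ∀ i j : Fin 3, ∃ k, k ≠ i ∧ k ≠ j := by decide
  obtain ⟨k, hki, hkj⟩ := hk i j
  have hi' : par y' = c i := hp ▸ hi
  have far : ∀ {v m}, h v = 1 → par v = c i → m ≠ i → ¬ G.Adj v (c m) := fun hv hvi hm =>
    hT.not_adj_cycle (by omega) (by rw [hvi]; exact hT.inj.ne hm.symm)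
  exact hG ⟨y, y', z, c k, c i, c j, hyy, hT.ne_cycle (by omega) k, hT.adj_of_par (by omega) hi,
    hT.adj_of_par (by omega) hi', hT.adj_of_par (by omega) hj, hT.adj_triangle hkj.symm,
    fun h => far hy hi hij.symm h.symm, fun h => far hy' hi' hij.symm h.symm,
    hT.not_adj_of_height_eq (by omega) (by omega),
    hT.not_adj_cycle (by omega) (by rw [hj]; exact hT.inj.ne hkj.symm),
    hT.not_adj_of_height_eq (by omega) (by omega), far hy hi hki,
    hT.not_adj_of_height_eq (by omega) (by omega), far hy' hi' hki⟩

theorem iso_of_three [Finite V] (hT : IsCycleWithTrees G c h par) (hG : ¬ HasTwoCherries G)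
    (hG' : ¬ HasTriangleAndCherry G) :
    (∃ L : Fin 3 → ℕ, (∀ i, L i ≤ 2) ∧
      Nonempty (G ≃g attachPaths (cycleGraph 3) (fun i => i) L)) ∨
    (∃ v : Fin 3, Nonempty (G ≃g attachPaths (cycleGraph 3) (fun _ : Fin 1 => v) (fun _ => 3))) ∨
    ∃ (v : Fin 3) (k : ℕ) (L : Fin k → ℕ), (∀ j, L j ≤ 2) ∧
      Nonempty (G ≃g attachPaths (cycleGraph 3) (fun _ : Fin k => v) L) := by
  classical
  have hle := hT.height_le_three hG'
  by_cases h3 : ∃ y, h y = 3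
  · right; left
    obtain ⟨y, hy⟩ := h3
    have e1 := hT.height_par y (by omega)
    have e2 := hT.height_par (par y) (by omega)
    obtain ⟨i, hi⟩ := hT.exists_par_eq (v := par (par y)) (by omega)
    have u2 : ∀ v, h v = 2 → v = par y := fun v hv => by
      have := hT.height_par v (by omega)
      exact hT.eq_of_two_le_height hG' (by omega) (by omega)
        (hT.eq_par_par_of_height_three hG hy (by omega))
    refine ⟨i, hT.nonempty_iso_attachPaths _ _
      (fun _ j => if j = 0 then par (par y) else if j = 1 then par y else y) ?_ ?_ ?_ ?_ ?_⟩
    · intro a j hj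
      rcases (show j = 0 ∨ j = 1 ∨ j = 2 by omega) with rfl | rfl | rfl <;> simp <;> omega
    · intro a ha
      simpa using hi
    · intro a j hj
      rcases (show j = 0 ∨ j = 1 by omega) with rfl | rfl <;> simp
    · intro a b _ _ _
      exact Subsingleton.elim a b
    · intro v hv
      have := hle v
      rcases (show h v = 1 ∨ h v = 2 ∨ h v = 3 by omega) with hv | hv | hv
      · exact ⟨0, 0, by simp, by simpa using (hT.eq_par_par_of_height_three hG hy hv).symm⟩
      · exact ⟨0, 1, by simp, by simpa using (u2 v hv).symm⟩
      · refine ⟨0, 2, by simp, ?_⟩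
        have := hT.height_par v (by omega)
        simpa using hT.eq_of_two_le_height hG' (by omega) (by omega) (u2 _ (by omega)).symm
  have htwo : ∀ v, h v ≠ 0 → h v = 1 ∨ h v = 2 := by
    intro v hv
    have := hle v
    by_contra hne
    exact h3 ⟨v, by omega⟩
  have hch : ∀ u, ∃ y, (∃ v, h v ≠ 0 ∧ par v = u) → h y ≠ 0 ∧ par y = u := by
    intro u
    by_cases hv : ∃ v, h v ≠ 0 ∧ par v = u
    · exact hv.imp fun v hv _ => hv
    · exact ⟨u, fun h => absurd h hv⟩
  choose ch hch using hch
  by_cases hsib : ∃ y y', h y = 1 ∧ h y' = 1 ∧ y ≠ y' ∧ par y = par y'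
  · right; right
    obtain ⟨y, y', hy, hy', hyy, hp⟩ := hsib
    obtain ⟨i, hi⟩ := hT.exists_par_eq hy
    -- All vertices of height one hang from the same root; each starts one path, of length two
    -- exactly when it has a child.
    obtain ⟨k, ⟨e⟩⟩ := Finite.exists_equiv_fin {v // h v = 1}
    have he : ∀ j, h (e.symm j).1 = 1 := fun j => (e.symm j).2
    refine ⟨i, k, fun j => if ∃ v, h v ≠ 0 ∧ par v = (e.symm j).1 then 2 else 1,
      fun j => by dsimp only; split_ifs <;> omega, hT.nonempty_iso_attachPaths _ _
        (fun j m => if m = 0 then (e.symm j).1 else ch (e.symm j).1) ?_ ?_ ?_ ?_ ?_⟩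
    · intro j m hm
      split_ifs at hm with hv
      · rcases (show m = 0 ∨ m = 1 by omega) with rfl | rfl
        · simpa using he j
        · simpa using hT.height_eq_of_par (hch _ hv).1 (hch _ hv).2 (he j)
      · obtain rfl : m = 0 := by omega
        simpa using he j
    · intro j _
      simp only [if_true]
      rw [hT.par_eq_of_siblings hG hy hy' hyy hp (he j), hi]
    · intro j m hm
      split_ifs at hm with hv
      · obtain rfl : m = 0 := by omega
        simpa using (hch _ hv).2
      · omega
    · intro j j' _ _ hjj
      exact e.symm.injective (Subtype.ext (by simpa using hjj))
    · intro v hv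
      rcases htwo v hv with hv1 | hv2
      · exact ⟨e ⟨v, hv1⟩, 0, by split_ifs <;> omega, by simp⟩
      · have e1 := hT.height_par v hv
        have hpv : h (par v) = 1 := by omega
        have hex : ∃ w, h w ≠ 0 ∧ par w = par v := ⟨v, hv, rfl⟩
        refine ⟨e ⟨par v, hpv⟩, 1, by simp only [Equiv.symm_apply_apply, if_pos hex]; omega, ?_⟩
        simp only [Equiv.symm_apply_apply, one_ne_zero, if_false]
        have e2 := hT.height_eq_of_par (hch _ hex).1 (hch _ hex).2 hpv
        exact hT.eq_of_two_le_height hG' (by omega) (by omega) (hch _ hex).2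
  · left
    -- Without siblings anywhere, each tree is a single path.
    have huniq : ∀ u v, h u ≠ 0 → h v ≠ 0 → par u = par v → u = v := by
      intro u v hu hv huv
      have e1 := hT.height_par u hu
      have e2 := hT.height_par v hv
      rw [huv] at e1
      by_cases h1 : h u = 1
      · by_contra hne
        exact hsib ⟨u, v, h1, by omega, hne, huv⟩
      · exact hT.eq_of_two_le_height hG' (by omega) (by omega) huv
    refine ⟨fun i => if ∃ v, h v ≠ 0 ∧ par v = c i then
        if ∃ v, h v ≠ 0 ∧ par v = ch (c i) then 2 else 1 else 0,
      fun i => by dsimp only; split_ifs <;> omega,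
      hT.nonempty_iso_attachPaths _ _ (fun i m => if m = 0 then ch (c i) else ch (ch (c i)))
        ?_ ?_ ?_ ?_ ?_⟩
    · intro i m hm
      split_ifs at hm with hv hw
      · have e1 := hT.height_eq_of_par (hch _ hv).1 (hch _ hv).2 (hT.height_cycle i)
        rcases (show m = 0 ∨ m = 1 by omega) with rfl | rfl
        · simpa using e1
        · simpa using hT.height_eq_of_par (hch _ hw).1 (hch _ hw).2 e1
      · have e1 := hT.height_eq_of_par (hch _ hv).1 (hch _ hv).2 (hT.height_cycle i)
        obtain rfl : m = 0 := by omega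
        simpa using e1
      · omega
    · intro i hi
      split_ifs at hi with hv hw
      · simpa using (hch _ hv).2
      · simpa using (hch _ hv).2
      · omega
    · intro i m hm
      split_ifs at hm with hv hw
      · obtain rfl : m = 0 := by omega
        simpa using (hch _ hw).2
      · omega
      · omega
    · intro i j hi hj hij
      have hvi : ∃ v, h v ≠ 0 ∧ par v = c i := by
        by_contra hno
        simp [if_neg hno] at hi
      have hvj : ∃ v, h v ≠ 0 ∧ par v = c j := by
        by_contra hno
        simp [if_neg hno] at hj
      simp only [if_true] at hij
      have := (hch _ hvi).2
      rw [hij, (hch _ hvj).2] at this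
      exact (hT.inj this).symm
    · intro v hv
      rcases htwo v hv with hv1 | hv2
      · obtain ⟨i, hi⟩ := hT.exists_par_eq hv1
        have hex : ∃ v, h v ≠ 0 ∧ par v = c i := ⟨v, hv, hi⟩
        refine ⟨i, 0, by simp only [if_pos hex]; split_ifs <;> omega, ?_⟩
        simpa using huniq _ _ (hch _ hex).1 hv ((hch _ hex).2.trans hi.symm)
      · have e1 := hT.height_par v hv
        obtain ⟨i, hi⟩ := hT.exists_par_eq (v := par v) (by omega)
        have hex : ∃ v, h v ≠ 0 ∧ par v = c i := ⟨par v, by omega, hi⟩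
        have e2 : ch (c i) = par v := huniq _ _ (hch _ hex).1 (by omega) ((hch _ hex).2.trans hi.symm)
        have hex2 : ∃ w, h w ≠ 0 ∧ par w = ch (c i) := ⟨v, hv, e2.symm⟩
        refine ⟨i, 1, by simp only [if_pos hex, if_pos hex2]; omega, ?_⟩
        simpa using huniq _ _ (hch _ hex2).1 hv ((hch _ hex2).2.trans e2)

end IsCycleWithTrees

end BoundedPowers

/-! ### The listed graphs have no obstruction. -/

namespace BoundedPowers

open SimpleGraph

section Embeddings

variable {V W : Type*} {G : SimpleGraph V} {H : SimpleGraph W}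

theorem HasTwoCherries.map (f : G ↪g H) (hG : HasTwoCherries G) : HasTwoCherries H := by
  obtain ⟨u₁, u₂, v₁, v₂, a, b, h⟩ := hG
  refine ⟨f u₁, f u₂, f v₁, f v₂, f a, f b, ?_⟩
  simpa only [f.map_adj_iff, ne_eq, f.injective.eq_iff] using h

theorem HasTriangleAndCherry.map (f : G ↪g H) (hG : HasTriangleAndCherry G) :
    HasTriangleAndCherry H := by
  obtain ⟨p, q, r, v₁, v₂, a, h⟩ := hG
  refine ⟨f p, f q, f r, f v₁, f v₂, f a, ?_⟩
  simpa only [f.map_adj_iff, ne_eq, f.injective.eq_iff] using h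

variable {U ι κ : Type*}

/-- Shortening or dropping some of the attached paths gives an induced subgraph. -/
def attachPathsEmbedding (H : SimpleGraph U) {r : ι → U} {L : ι → ℕ} {s : κ → U} {M : κ → ℕ}
    (f : ι ↪ κ) (hr : ∀ i, s (f i) = r i) (hL : ∀ i, L i ≤ M (f i)) :
    attachPaths H r L ↪g attachPaths H s M where
  toFun := Sum.map id fun q => ⟨f q.1, Fin.castLE (hL q.1) q.2⟩
  inj' := by
    refine Function.Injective.sumMap Function.injective_id ?_
    rintro ⟨i, j⟩ ⟨i', j'⟩ h
    simp only [Sigma.mk.injEq, EmbeddingLike.apply_eq_iff_eq] at h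
    obtain ⟨rfl, h⟩ := h
    simpa using h
  map_rel_iff' := by
    rintro (u | q) (u' | q')
    · exact Iff.rfl
    · change u = s (f q'.1) ∧ _ ↔ u = r q'.1 ∧ _
      rw [hr]; rfl
    · change u' = s (f q.1) ∧ _ ↔ u' = r q.1 ∧ _
      rw [hr]; rfl
    · change f q.1 = f q'.1 ∧ _ ↔ q.1 = q'.1 ∧ _
      rw [f.injective.eq_iff]; rfl

end Embeddings

instance decidableRelAttachPaths {U ι : Type*} [DecidableEq U] [DecidableEq ι] (H : SimpleGraph U)
    [DecidableRel H.Adj] (r : ι → U) (L : ι → ℕ) : DecidableRel (attachPaths H r L).Adj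
  | Sum.inl u, Sum.inl v => inferInstanceAs (Decidable (H.Adj u v))
  | Sum.inl u, Sum.inr q => inferInstanceAs (Decidable (u = r q.1 ∧ (q.2 : ℕ) = 0))
  | Sum.inr q, Sum.inl u => inferInstanceAs (Decidable (u = r q.1 ∧ (q.2 : ℕ) = 0))
  | Sum.inr q, Sum.inr q' => inferInstanceAs (Decidable
      (q.1 = q'.1 ∧ ((q.2 : ℕ) + 1 = (q'.2 : ℕ) ∨ (q'.2 : ℕ) + 1 = (q.2 : ℕ))))

/-- The hypotheses are interleaved with the quantifiers so that evaluation by `decide` discards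
candidates early. -/
theorem not_hasTwoCherries_iff {V : Type*} {G : SimpleGraph V} : ¬ HasTwoCherries G ↔
    ∀ a u₁, G.Adj a u₁ → ∀ u₂, G.Adj a u₂ → u₁ ≠ u₂ → ¬ G.Adj u₁ u₂ → ∀ b, ¬ G.Adj b u₁ →
      ¬ G.Adj b u₂ → ∀ v₁, G.Adj b v₁ → ¬ G.Adj u₁ v₁ → ¬ G.Adj u₂ v₁ → ∀ v₂, G.Adj b v₂ →
        ¬ G.Adj u₁ v₂ → ¬ G.Adj u₂ v₂ → v₁ ≠ v₂ → G.Adj v₁ v₂ := by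
  constructor
  · intro h a u₁ h1 u₂ h2 hu hn b b1 b2 v₁ h3 n1 n2 v₂ h4 n3 n4 hv
    by_contra hn'
    exact h ⟨u₁, u₂, v₁, v₂, a, b, hu, hv, h1, h2, h3, h4, b1, b2, hn, hn', n1, n3, n2, n4⟩
  · rintro h ⟨u₁, u₂, v₁, v₂, a, b, hu, hv, h1, h2, h3, h4, b1, b2, hn, hn', n1, n3, n2, n4⟩
    exact hn' (h a u₁ h1 u₂ h2 hu hn b b1 b2 v₁ h3 n1 n2 v₂ h4 n3 n4 hv)

theorem not_hasTriangleAndCherry_iff {V : Type*} {G : SimpleGraph V} : ¬ HasTriangleAndCherry G ↔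
    ∀ a v₁, G.Adj a v₁ → ∀ v₂, G.Adj a v₂ → v₁ ≠ v₂ → ¬ G.Adj v₁ v₂ → ∀ p, ¬ G.Adj p v₁ →
      ¬ G.Adj p v₂ → ∀ q, G.Adj p q → ¬ G.Adj q v₁ → ¬ G.Adj q v₂ → ∀ r, G.Adj q r →
        ¬ G.Adj r v₁ → ¬ G.Adj r v₂ → ¬ G.Adj p r := by
  constructor
  · intro h a v₁ h1 v₂ h2 hv hn p p1 p2 q hpq q1 q2 r hqr r1 r2 hpr
    exact h ⟨p, q, r, v₁, v₂, a, hpq, hqr, hpr, hv, h1, h2, hn, p1, q1, r1, p2, q2, r2⟩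
  · rintro h ⟨p, q, r, v₁, v₂, a, hpq, hqr, hpr, hv, h1, h2, hn, p1, q1, r1, p2, q2, r2⟩
    exact h a v₁ h1 v₂ h2 hv hn p p1 p2 q hpq q1 q2 r hqr r1 r2 hpr

section Finite

set_option synthInstance.maxSize 2000
set_option synthInstance.maxHeartbeats 400000

theorem not_hasTwoCherries_four_pendants :
    ¬ HasTwoCherries (attachPaths (cycleGraph 4) (fun i : Fin 4 => i) (fun _ => 1)) := by
  rw [not_hasTwoCherries_iff]
  decide +kernel

theorem not_hasTwoCherries_four_opposite :
    ¬ HasTwoCherries (attachPaths (cycleGraph 4) (fun i : Fin 4 => i) ![2, 0, 1, 0]) := by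
  rw [not_hasTwoCherries_iff]
  decide +kernel

theorem not_hasTwoCherries_four_path (v : Fin 4) :
    ¬ HasTwoCherries (attachPaths (cycleGraph 4) (fun _ : Fin 1 => v) (fun _ => 2)) := by
  rw [not_hasTwoCherries_iff]
  revert v
  decide +kernel

theorem not_hasTwoCherries_three_paths :
    ¬ HasTwoCherries (attachPaths (cycleGraph 3) (fun i : Fin 3 => i) (fun _ => 2)) := by
  rw [not_hasTwoCherries_iff]
  decide +kernel

theorem not_hasTriangleAndCherry_three_paths :
    ¬ HasTriangleAndCherry (attachPaths (cycleGraph 3) (fun i : Fin 3 => i) (fun _ => 2)) := by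
  rw [not_hasTriangleAndCherry_iff]
  decide +kernel

theorem not_hasTwoCherries_three_path (v : Fin 3) :
    ¬ HasTwoCherries (attachPaths (cycleGraph 3) (fun _ : Fin 1 => v) (fun _ => 3)) := by
  rw [not_hasTwoCherries_iff]
  revert v
  decide +kernel

theorem not_hasTriangleAndCherry_three_path (v : Fin 3) :
    ¬ HasTriangleAndCherry (attachPaths (cycleGraph 3) (fun _ : Fin 1 => v) (fun _ => 3)) := by
  rw [not_hasTriangleAndCherry_iff]
  revert v
  decide +kernel

end Finite

section Star

variable {V : Type*} {G : SimpleGraph V} {x : V}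

/-- Every cherry has the hub `x` as centre or as leaf, and two cherries that share it in either way
violate the required nonadjacencies. -/
theorem not_hasTwoCherries_of_star (hx : ∀ a u₁ u₂, a ≠ x → G.Adj a u₁ → G.Adj a u₂ → u₁ ≠ u₂ →
    ¬ G.Adj u₁ u₂ → u₁ = x ∨ u₂ = x) : ¬ HasTwoCherries G := by
  rintro ⟨u₁, u₂, v₁, v₂, a, b, hu, hv, h1, h2, h3, h4, b1, b2, hn, hn', n11, n12, n21, n22⟩
  by_cases hb : b = x
  · subst hb
    by_cases ha : a = b
    · subst ha
      exact b1 h1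
    · rcases hx a u₁ u₂ ha h1 h2 hu hn with rfl | rfl
      exacts [n11 h3, n21 h3]
  · by_cases ha : a = x
    · subst ha
      rcases hx b v₁ v₂ hb h3 h4 hv hn' with rfl | rfl
      exacts [n11 h1.symm, n12 h1.symm]
    · rcases hx b v₁ v₂ hb h3 h4 hv hn' with rfl | rfl <;>
        rcases hx a u₁ u₂ ha h1 h2 hu hn with rfl | rfl
      exacts [b1 h3, b2 h3, b1 h4, b2 h4]

theorem not_hasTriangleAndCherry_of_star (hx : ∀ a u₁ u₂, a ≠ x → G.Adj a u₁ → G.Adj a u₂ →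
    u₁ ≠ u₂ → ¬ G.Adj u₁ u₂ → u₁ = x ∨ u₂ = x)
    (hT : ∀ p q r, G.Adj p q → G.Adj q r → G.Adj p r → p = x ∨ q = x ∨ r = x) :
    ¬ HasTriangleAndCherry G := by
  rintro ⟨p, q, r, v₁, v₂, a, hpq, hqr, hpr, hv, h1, h2, hn, p1, q1, r1, p2, q2, r2⟩
  by_cases ha : a = x
  · subst ha
    rcases hT p q r hpq hqr hpr with rfl | rfl | rfl
    exacts [p1 h1, q1 h1, r1 h1]
  · rcases hx a v₁ v₂ ha h1 h2 hv hn with rfl | rfl <;>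
      rcases hT p q r hpq hqr hpr with rfl | rfl | rfl
    exacts [q1 hpq.symm, r1 hqr.symm, p1 hpr, q2 hpq.symm, r2 hqr.symm, p2 hpr]

variable {ι : Type*} {v : Fin 3} {L : ι → ℕ}

theorem attachPaths_three_star (hL : ∀ j, L j ≤ 2) (a u₁ u₂ : Fin 3 ⊕ (Σ i, Fin (L i)))
    (ha : a ≠ Sum.inl v) (h1 : (attachPaths (cycleGraph 3) (fun _ => v) L).Adj a u₁)
    (h2 : (attachPaths (cycleGraph 3) (fun _ => v) L).Adj a u₂) (hu : u₁ ≠ u₂)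
    (hn : ¬ (attachPaths (cycleGraph 3) (fun _ => v) L).Adj u₁ u₂) :
    u₁ = Sum.inl v ∨ u₂ = Sum.inl v := by
  rw [cycleGraph_three_eq_top] at h1 h2 hn
  rcases a with a | ⟨i, k, hk⟩ <;> rcases u₁ with u₁ | ⟨i₁, k₁, hk₁⟩ <;>
    rcases u₂ with u₂ | ⟨i₂, k₂, hk₂⟩ <;> simp only [attachPaths, top_adj] at h1 h2 hn
  · exact absurd (congrArg Sum.inl (not_not.1 hn)) hu
  · exact absurd (congrArg Sum.inl h2.1) ha
  · exact absurd (congrArg Sum.inl h1.1) ha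
  · exact absurd (congrArg Sum.inl h1.1) ha
  · exact Or.inl (congrArg Sum.inl h1.1)
  · exact Or.inl (congrArg Sum.inl h1.1)
  · exact Or.inr (congrArg Sum.inl h2.1)
  · obtain ⟨rfl, h1⟩ := h1
    obtain ⟨rfl, h2⟩ := h2
    have := hL i
    obtain rfl : k₁ = k₂ := by omega
    exact absurd rfl hu

theorem attachPaths_three_triangle (p q r : Fin 3 ⊕ (Σ i, Fin (L i)))
    (hpq : (attachPaths (cycleGraph 3) (fun _ => v) L).Adj p q)
    (hqr : (attachPaths (cycleGraph 3) (fun _ => v) L).Adj q r)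
    (hpr : (attachPaths (cycleGraph 3) (fun _ => v) L).Adj p r) :
    p = Sum.inl v ∨ q = Sum.inl v ∨ r = Sum.inl v := by
  rw [cycleGraph_three_eq_top] at hpq hqr hpr
  rcases p with p | ⟨i, k, hk⟩ <;> rcases q with q | ⟨i₁, k₁, hk₁⟩ <;>
    rcases r with r | ⟨i₂, k₂, hk₂⟩ <;> simp only [attachPaths, top_adj] at hpq hqr hpr <;>
    simp only [Sum.inl.injEq, reduceCtorEq, or_false, false_or] <;> omega

theorem not_hasTwoCherries_three_star (hL : ∀ j, L j ≤ 2) :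
    ¬ HasTwoCherries (attachPaths (cycleGraph 3) (fun _ => v) L) :=
  not_hasTwoCherries_of_star (attachPaths_three_star hL)

theorem not_hasTriangleAndCherry_three_star (hL : ∀ j, L j ≤ 2) :
    ¬ HasTriangleAndCherry (attachPaths (cycleGraph 3) (fun _ => v) L) :=
  not_hasTriangleAndCherry_of_star (attachPaths_three_star hL) attachPaths_three_triangle

end Star

end BoundedPowers

/-! ### The classification. -/

theorem mainTheorem1 {V : Type*} [Finite V] {K : Type*} [Field K] (G : SimpleGraph V)
    (hG : BoundedPowers.IsUnicyclic G) {x : V} (C : G.Walk x x) (hC : C.IsCycle)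
    (l : ℕ) (hl : C.length = l) :
    (8 ≤ l → ¬ BoundedPowers.EnjoysStrongExchange K G) ∧
    (l = 5 ∨ l = 6 ∨ l = 7 → (BoundedPowers.EnjoysStrongExchange K G ↔ G.indepNum ≤ 3)) ∧
    (l = 4 → (BoundedPowers.EnjoysStrongExchange K G ↔
      (∃ L : Fin 4 → ℕ, (∀ i, L i ≤ 1) ∧
        Nonempty (G ≃g BoundedPowers.attachPaths (SimpleGraph.cycleGraph 4) (fun i => i) L)) ∨
      Nonempty (G ≃g
        BoundedPowers.attachPaths (SimpleGraph.cycleGraph 4) (fun i => i) ![2, 0, 1, 0]) ∨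
      (∃ v : Fin 4, Nonempty (G ≃g
        BoundedPowers.attachPaths (SimpleGraph.cycleGraph 4) (fun _ : Fin 1 => v)
          (fun _ => 2))))) ∧
    (l = 3 → (BoundedPowers.EnjoysStrongExchange K G ↔
      (∃ L : Fin 3 → ℕ, (∀ i, L i ≤ 2) ∧
        Nonempty (G ≃g BoundedPowers.attachPaths (SimpleGraph.cycleGraph 3) (fun i => i) L)) ∨
      (∃ v : Fin 3, Nonempty (G ≃g
        BoundedPowers.attachPaths (SimpleGraph.cycleGraph 3) (fun _ : Fin 1 => v)
          (fun _ => 3))) ∨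
      (∃ (v : Fin 3) (k : ℕ) (L : Fin k → ℕ), (∀ j, L j ≤ 2) ∧ Nonempty (G ≃g
        BoundedPowers.attachPaths (SimpleGraph.cycleGraph 3) (fun _ : Fin k => v) L)))) := by
  obtain ⟨c, h, par, hT⟩ : ∃ (c : Fin l → V) (h : V → ℕ) (par : V → V),
      BoundedPowers.IsCycleWithTrees G c h par := by
    subst hl
    exact hG.exists_isCycleWithTrees hC
  have tri : 4 ≤ l → ¬ BoundedPowers.HasTriangleAndCherry G := by
    rintro hn ⟨p, q, r, -, -, -, hpq, hqr, hpr, -⟩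
    exact hT.not_triangle hn hpq hqr hpr
  have enjoys : 4 ≤ l → ¬ BoundedPowers.HasTwoCherries G →
      BoundedPowers.EnjoysStrongExchange K G := fun hn h1 =>
    BoundedPowers.enjoysStrongExchange K h1 (tri hn) fun p q r _ _ _ hpq hqr hpr =>
      absurd hpr (hT.not_triangle hn hpq hqr)
  have cherries : BoundedPowers.EnjoysStrongExchange K G → ¬ BoundedPowers.HasTwoCherries G :=
    fun hS h1 => h1.not_enjoysStrongExchange K hS
  refine ⟨fun hl8 hS => cherries hS (hT.hasTwoCherries_of_eight_le hl8), fun hl57 => ⟨fun hS =>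
    hT.indepNum_le_three hl57 (cherries hS), fun hα => enjoys (by omega) fun h1 => ?_⟩, ?_, ?_⟩
  · have := h1.four_le_indepNum
    omega
  · intro hl4
    subst hl4
    refine ⟨fun hS => hT.iso_of_four (cherries hS), fun hiso => enjoys le_rfl fun h1 => ?_⟩
    rcases hiso with ⟨L, hL, ⟨e⟩⟩ | ⟨⟨e⟩⟩ | ⟨v, ⟨e⟩⟩
    -- Obstructions persist under induced embeddings, so only the largest graph of the family needs
    -- checking.
    · exact BoundedPowers.not_hasTwoCherries_four_pendants ((h1.map e.toRelEmbedding).map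
        (BoundedPowers.attachPathsEmbedding _ (Function.Embedding.refl _) (fun _ => rfl) hL))
    · exact BoundedPowers.not_hasTwoCherries_four_opposite (h1.map e.toRelEmbedding)
    · exact BoundedPowers.not_hasTwoCherries_four_path v (h1.map e.toRelEmbedding)
  · intro hl3
    subst hl3
    refine ⟨fun hS => hT.iso_of_three (cherries hS)
      fun h2 => h2.not_enjoysStrongExchange K hS, fun hiso => ?_⟩
    suffices ¬ BoundedPowers.HasTwoCherries G ∧ ¬ BoundedPowers.HasTriangleAndCherry G from
      BoundedPowers.enjoysStrongExchange K this.1 this.2 (hT.trianglesCoincide rfl)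
    rcases hiso with ⟨L, hL, ⟨e⟩⟩ | ⟨v, ⟨e⟩⟩ | ⟨v, k, L, hL, ⟨e⟩⟩
    · have f := BoundedPowers.attachPathsEmbedding (SimpleGraph.cycleGraph 3) (s := fun i => i)
        (M := fun _ => 2) (Function.Embedding.refl _) (fun _ => rfl) hL
      exact ⟨fun h1 => BoundedPowers.not_hasTwoCherries_three_paths
          ((h1.map e.toRelEmbedding).map f),
        fun h2 => BoundedPowers.not_hasTriangleAndCherry_three_paths
          ((h2.map e.toRelEmbedding).map f)⟩
    · exact ⟨fun h1 => BoundedPowers.not_hasTwoCherries_three_path v (h1.map e.toRelEmbedding),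
        fun h2 => BoundedPowers.not_hasTriangleAndCherry_three_path v (h2.map e.toRelEmbedding)⟩
    · exact ⟨fun h1 => BoundedPowers.not_hasTwoCherries_three_star hL (h1.map e.toRelEmbedding),
        fun h2 => BoundedPowers.not_hasTriangleAndCherry_three_star hL (h2.map e.toRelEmbedding)⟩
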